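/- **Setting.** Let $(\Omega,\mathcal F,P)$ be a complete probability space, $B\subset(0,\infty)$ a Borel set, $G$ a probability measure on $B$, $\beta>0$, and let $\mu(dt\,dy)$ be a Poisson random measure on $[0,\infty)\times B$ with intensity (compensator) $dt\,\beta G(dy)$. Let $(\mathcal F_t)_{t\ge 0}$ be the natural filtration of $\mu$, completed by the $P$-null sets. Let $f:[0,\infty)\times\mathbb R\to[0,\infty)$ be a continuous function such that $f(\cdot,y)$ is convex, non-decreasing, Lipschitz with a constant $K_0$ independent of $y$, and $f(0,y)=0$, for all $y\ge 0$; $f(n,\cdot)$ is non-decreasing and $f(n,0)=0$ for all $n\ge0$; and $f(n,y)>0$ if $n>0$ and $y>0$. Let $Y$ have law $G$, let $0\le k_1<k_2$, $\zeta_0>0$, and put $$\nu=E[f(1,Y)],\qquad a=\frac1{\zeta_0\nu},\qquad p(u)=(1+k_1)\beta\nu-(1+k_2)\beta E[f(1,(Y-u)^+)].$$ Let $\underline u>0$ be such that $p(u)\ge\beta E[f(1,Y\wedge u)]$ for all $u\ge\underline u$, and assume that $aK_0\le 1$. For an initial reserve $x\ge0$, a progressively measurable process $u\ge\underline u$ (retention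 level) and an adapted càdlàg non-decreasing process $L$ with $L_{0-}=0$ (cumulative dividends; $L_0\geq 0$ is allowed to be positive), let $X^{x,u,L}$ be the adapted càdlàg solution, unique up to indistinguishability, of $$X_t=x+a\int_0^tX_s\,p(u_s)\,ds-\int_{[0,t]\times B}f\big(aX_{s-}^+,\,y\wedge u_s\big)\,\mu(ds\,dy)-L_t,\qquad t\ge0.$$ The pair $(u,L)$ is called an *admissible strategy for $x$* if moreover $L_t-L_{t-}\le X^{x,u,L}_{t-}$ for $dt\otimes dP$-almost every $(t,\omega)$. The ruin time from $x$ is $\tau^{x,u,L}=\inf\{t\ge0:X^{x,u,L}_t\le0\}\in[0,\infty]$. **Proposition.** Let $0\le x\le x'$ and let $(u,L)$ be an admissible strategy for $x$. Then $(u,L)$ is also an admissible strategy for $x'$ (in particular the solution $X^{x',u,L}$ exists). Moreover, $$\tau^{x,u,L}\le\tau^{x',u,L}\qquad P\text{-a.s.}$$ -/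

import Mathlib

open MeasureTheory ProbabilityTheory Filter Topology Set
open scoped NNReal ENNReal

noncomputable section

namespace Reinsurance

/-- `N` is a Poisson random measure on `E = [0,∞) × ℝ` (time, mark) with intensity measure `Λ`:
an integer-valued random measure which charges each time by at most one point, whose
value on a set `A` of finite intensity has the Poisson law of mean `Λ A`, and whose values
on disjoint sets are independent. -/
structure IsPoissonRandomMeasure {Ω : Type*} [MeasurableSpace Ω] (P : Measure Ω)
    (Λ : Measure (ℝ≥0 × ℝ)) (N : Ω → Measure (ℝ≥0 × ℝ)) : Prop where
  measurable : Measurable N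
  integerValued : ∀ᵐ ω ∂P, ∀ A, MeasurableSet A → ∃ n : ℕ∞, N ω A = (n : ℝ≥0∞)
  timeSimple : ∀ᵐ ω ∂P, ∀ t : ℝ≥0, N ω ({t} ×ˢ univ) ≤ 1
  poissonLaw : ∀ A, MeasurableSet A → Λ A ≠ ∞ →
    P.map (fun ω => N ω A) = (poissonMeasure (Λ A).toNNReal).map (fun n : ℕ => (n : ℝ≥0∞))
  indep : ∀ (n : ℕ) (A : Fin n → Set (ℝ≥0 × ℝ)), (∀ i, MeasurableSet (A i)) →
    Pairwise (fun i j => Disjoint (A i) (A j)) → iIndepFun (fun i ω => N ω (A i)) P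

/-- Lebesgue measure `dt` on `[0,∞)`. -/
def timeMeasure : Measure ℝ≥0 := (volume.restrict (Ici (0 : ℝ))).map Real.toNNReal

theorem measurable_measure_restrict {E : Type*} [MeasurableSpace E] {S : Set E}
    (hS : MeasurableSet S) : Measurable (fun m : Measure E => m.restrict S) := by
  refine Measure.measurable_of_measurable_coe _ fun A hA => ?_
  simp only [Measure.restrict_apply hA]
  exact Measure.measurable_coe (hA.inter hS)

/-- The natural filtration of the random measure `N`, completed by the `P`-null sets: at time `t`
it is generated by the restriction of `N` to `[0,t] × ℝ` and by the null sets. -/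
def naturalFiltration {Ω : Type*} [mΩ : MeasurableSpace Ω] (P : Measure Ω) [P.IsComplete]
    (N : Ω → Measure (ℝ≥0 × ℝ)) (hN : Measurable N) : Filtration ℝ≥0 mΩ where
  seq t := MeasurableSpace.comap (fun ω => (N ω).restrict (Iic t ×ˢ univ)) inferInstance ⊔
    MeasurableSpace.generateFrom {s | P s = 0}
  mono' := by
    intro s t hst
    refine sup_le_sup ?_ le_rfl
    have h : (fun ω => (N ω).restrict (Iic s ×ˢ (univ : Set ℝ))) =
        (fun m : Measure (ℝ≥0 × ℝ) => m.restrict (Iic s ×ˢ univ)) ∘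
          (fun ω => (N ω).restrict (Iic t ×ˢ univ)) := by
      funext ω
      have hsub : (Iic s ×ˢ (univ : Set ℝ)) ⊆ Iic t ×ˢ univ :=
        prod_mono (Iic_subset_Iic.2 hst) le_rfl
      simp [Measure.restrict_restrict_of_subset hsub]
    rw [h, ← MeasurableSpace.comap_comp]
    exact MeasurableSpace.comap_mono
      (measurable_measure_restrict (measurableSet_Iic.prod MeasurableSet.univ)).comap_le
  le' := by
    intro t
    refine sup_le ?_ ?_
    · exact ((measurable_measure_restrict
        (measurableSet_Iic.prod MeasurableSet.univ)).comp hN).comap_le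
    · exact MeasurableSpace.generateFrom_le fun s hs => measurableSet_of_null hs

/-- Right-continuous with left limits. -/
def IsCadlag (g : ℝ≥0 → ℝ) : Prop :=
  ∀ t, ContinuousWithinAt g (Ici t) t ∧ ∃ l, Tendsto g (𝓝[<] t) (𝓝 l)

/-- The assumptions on the function `f (number of contracts) (risk)` modelling the claims;
`K₀` is its Lipschitz constant in the number of contracts. -/
structure IsClaimFunction (f : ℝ≥0 → ℝ → ℝ≥0) (K₀ : ℝ≥0) : Prop where
  convex : ∀ y, 0 ≤ y → ConvexOn ℝ≥0 univ (fun n => f n y)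
  mono_left : ∀ y, 0 ≤ y → Monotone (fun n => f n y)
  zero_left : ∀ y, 0 ≤ y → f 0 y = 0
  mono_right : ∀ n, Monotone (f n)
  zero_right : ∀ n, f n 0 = 0
  pos : ∀ n y, 0 < n → 0 < y → 0 < f n y
  continuous : Continuous (fun q : ℝ≥0 × ℝ => f q.1 q.2)
  lipschitz : ∀ y, 0 ≤ y → LipschitzWith K₀ (fun n => f n y)

/-- The data of the insurance model: the set `B` of claim sizes, the claim size law `G`, the
claim intensity `β`, the claim function `f`, the safety loadings `k₁, k₂`, the solvency
coefficient `ζ₀` and the minimal retention level `uMin`. -/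
structure Model where
  B : Set ℝ
  G : Measure ℝ
  β : ℝ
  f : ℝ≥0 → ℝ → ℝ≥0
  k₁ : ℝ
  k₂ : ℝ
  ζ₀ : ℝ
  uMin : ℝ

namespace Model

variable (M : Model)

/-- `ν = E[f(1, Y)]`, the average claim per contract. -/
def ν : ℝ := ∫ y, (M.f 1 y : ℝ) ∂M.G

/-- The premium rate per contract
`p(u) = (1 + k₁) β ν - (1 + k₂) β E[f(1, (Y - u)⁺)]`. -/
def p (u : ℝ) : ℝ :=
  (1 + M.k₁) * M.β * M.ν - (1 + M.k₂) * M.β * ∫ y, (M.f 1 (max (y - u) 0) : ℝ) ∂M.G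

/-- `a = 1 / (ζ₀ ν)`: the company with fortune `X` has `a X` contracts. -/
def a : ℝ := 1 / (M.ζ₀ * M.ν)

/-- The intensity measure `dt ⊗ β G(dy)` of the claims. -/
def intensity : Measure (ℝ≥0 × ℝ) :=
  timeMeasure.prod (ENNReal.ofReal M.β • M.G)

/-- The standing assumptions of the model; `K₀` is the Lipschitz constant of the claim function,
and the monetary unit is such that `a K₀ ≤ 1`. -/
structure IsValid (K₀ : ℝ≥0) : Prop where
  measurableSet_B : MeasurableSet M.B
  B_pos : M.B ⊆ Ioi 0
  isProbabilityMeasure_G : IsProbabilityMeasure M.G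
  G_compl_B : M.G M.Bᶜ = 0
  β_pos : 0 < M.β
  claim : IsClaimFunction M.f K₀
  k₁_nonneg : 0 ≤ M.k₁
  k₁_lt_k₂ : M.k₁ < M.k₂
  ζ₀_pos : 0 < M.ζ₀
  uMin_pos : 0 < M.uMin
  premium_covers : ∀ u, M.uMin ≤ u → M.β * ∫ y, (M.f 1 (min y u) : ℝ) ∂M.G ≤ M.p u
  a_mul_K₀_le_one : M.a * K₀ ≤ 1

variable {Ω : Type*} [mΩ : MeasurableSpace Ω]

/-- `X` is the fortune process `X^{x,u,L}`: the adapted càdlàg solution of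
`X_t = x + a ∫₀ᵗ X_s p(u_s) ds - ∫_{[0,t] × B} f(a X_{s-}, y ∧ u_s) N(ds dy) - L_t`,
where `L_t` is the integral of `dL` over `[0,t]`, an initial payment `L_0` included.
The number of contracts in the claim term is `0` when `X_{s-}` is negative. -/
structure IsReserve (P : Measure Ω) (ℱ : Filtration ℝ≥0 mΩ) (N : Ω → Measure (ℝ≥0 × ℝ))
    (x : ℝ) (u L : ℝ≥0 → Ω → ℝ) (X : ℝ≥0 → Ω → ℝ) : Prop where
  adapted : StronglyAdapted ℱ X
  cadlag : ∀ᵐ ω ∂P, IsCadlag (fun t => X t ω)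
  equation : ∀ᵐ ω ∂P, ∀ t : ℝ≥0,
    X t ω = x + M.a * ∫ s in Iic t, X s ω * M.p (u s ω) ∂timeMeasure
      - ∫ z in Iic t ×ˢ M.B,
          (M.f (M.a * Function.leftLim (fun s => X s ω) z.1).toNNReal (min z.2 (u z.1 ω)) : ℝ) ∂N ω
      - L t ω

/-- `(u, L) ∈ 𝒜(x)`: the pair `(u, L)` of a retention level process and a cumulative dividend
process is an admissible strategy for the initial reserve `x`. The condition `0 ≤ L_0`
is monotonicity at `0`, as `L_{0-} = 0`. -/
structure IsAdmissible (P : Measure Ω) (ℱ : Filtration ℝ≥0 mΩ) (N : Ω → Measure (ℝ≥0 × ℝ))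
    (x : ℝ) (u L : ℝ≥0 → Ω → ℝ) : Prop where
  progressive_u : IsStronglyProgressive ℱ u
  uMin_le : ∀ᵐ ω ∂P, ∀ t, M.uMin ≤ u t ω
  adapted_L : StronglyAdapted ℱ L
  cadlag_L : ∀ᵐ ω ∂P, IsCadlag (fun t => L t ω)
  monotone_L : ∀ᵐ ω ∂P, Monotone (fun t => L t ω)
  zero_le_L : ∀ᵐ ω ∂P, 0 ≤ L 0 ω
  dividend_le : ∃ X, M.IsReserve P ℱ N x u L X ∧
    ∀ᵐ q : Ω × ℝ≥0 ∂(P.prod timeMeasure),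
      L q.2 q.1 - Function.leftLim (fun s => L s q.1) q.2
        ≤ Function.leftLim (fun s => X s q.1) q.2

end Model

/-- The ruin time `inf {t ≥ 0 : X_t ≤ 0}`, equal to `∞` if there is no such `t`. -/
def ruinTime {Ω : Type*} (X : ℝ≥0 → Ω → ℝ) (ω : Ω) : ℝ≥0∞ :=
  ⨅ (t : ℝ≥0) (_ : X t ω ≤ 0), (t : ℝ≥0∞)

end Reinsurance

end

noncomputable section

namespace Reinsurance

/-! ### Càdlàg functions -/

/-! Everything rests on the difference `D = X' - X` of two reserves driven by the same `u` and `L`.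
The dividends cancel, so `D` solves a linear equation: between claims it grows at the rate `a p(u) ≥
0`, and at a claim it drops by the difference of the two payments. Since `f` is `K₀`-Lipschitz in
the number of contracts and `a K₀ ≤ 1`, this drop is at most `|D_{s-}|`. Almost surely claims are
locally finite in time and never simultaneous, so `D`, starting at `x' - x ≥ 0`, cannot become
negative (`nonneg_of_equation`, `Model.IsReserve.ae_le`). Hence `X ≤ X'`, also for left limits: the
dividend constraint passes from `X` to `X'`, and `X'` can be nonpositive only where `X` is.

Existence of `X'` is obtained by solving the equation of `D` path by path and putting `X' = X + D`
(`Model.IsValid.reserve_add_iff`). The linear drift is integrated exactly by variation of constants,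
so a Picard step only needs left limits at claim times. Each step therefore makes the iterate
correct up to one more claim, and at a fixed time the iteration becomes stationary
(`picard_eq_solution`, `solution_equation`). Every iterate is adapted, being built from data up to
time `t`, and so is the pointwise limit (`measurable_solution`). Exceptional paths are modified on a
null set, which the completed filtration allows (`Model.IsReserve.exists_of_initial`). -/

theorem IsCadlag.tendsto_leftLim {g : ℝ≥0 → ℝ} (h : IsCadlag g) (t : ℝ≥0) :
    Tendsto g (𝓝[<] t) (𝓝 (Function.leftLim g t)) :=
  tendsto_leftLim_of_tendsto (h t).2

theorem leftLim_zero (g : ℝ≥0 → ℝ) : Function.leftLim g 0 = g 0 :=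
  leftLim_eq_of_isBot fun _ => zero_le

theorem neBot_nhdsLT {t : ℝ≥0} (ht : 0 < t) : (𝓝[<] t).NeBot :=
  nhdsLT_neBot_of_exists_lt ⟨0, ht⟩

theorem IsCadlag.leftLim_eq {g : ℝ≥0 → ℝ} {t : ℝ≥0} {l : ℝ} (ht : 0 < t)
    (h : Tendsto g (𝓝[<] t) (𝓝 l)) : Function.leftLim g t = l := by
  have := neBot_nhdsLT ht
  exact leftLim_eq_of_tendsto h

theorem isCadlag_of_continuous {g : ℝ≥0 → ℝ} (h : Continuous g) : IsCadlag g := fun t =>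
  ⟨h.continuousWithinAt, g t, h.continuousWithinAt⟩

theorem IsCadlag.add {g h : ℝ≥0 → ℝ} (hg : IsCadlag g) (hh : IsCadlag h) :
    IsCadlag fun t => g t + h t := fun t =>
  ⟨(hg t).1.add (hh t).1, _, (hg.tendsto_leftLim t).add (hh.tendsto_leftLim t)⟩

theorem IsCadlag.sub {g h : ℝ≥0 → ℝ} (hg : IsCadlag g) (hh : IsCadlag h) :
    IsCadlag fun t => g t - h t := fun t =>
  ⟨(hg t).1.sub (hh t).1, _, (hg.tendsto_leftLim t).sub (hh.tendsto_leftLim t)⟩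

theorem IsCadlag.mul {g h : ℝ≥0 → ℝ} (hg : IsCadlag g) (hh : IsCadlag h) :
    IsCadlag fun t => g t * h t := fun t =>
  ⟨(hg t).1.mul (hh t).1, _, (hg.tendsto_leftLim t).mul (hh.tendsto_leftLim t)⟩

theorem IsCadlag.leftLim_add {g h : ℝ≥0 → ℝ} (hg : IsCadlag g) (hh : IsCadlag h) (t : ℝ≥0) :
    Function.leftLim (fun s => g s + h s) t = Function.leftLim g t + Function.leftLim h t := by
  rcases eq_or_ne t 0 with rfl | ht
  · simp only [leftLim_zero]
  · exact IsCadlag.leftLim_eq (pos_iff_ne_zero.2 ht)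
      ((hg.tendsto_leftLim t).add (hh.tendsto_leftLim t))

theorem IsCadlag.leftLim_sub {g h : ℝ≥0 → ℝ} (hg : IsCadlag g) (hh : IsCadlag h) (t : ℝ≥0) :
    Function.leftLim (fun s => g s - h s) t = Function.leftLim g t - Function.leftLim h t := by
  rcases eq_or_ne t 0 with rfl | ht
  · simp only [leftLim_zero]
  · exact IsCadlag.leftLim_eq (pos_iff_ne_zero.2 ht)
      ((hg.tendsto_leftLim t).sub (hh.tendsto_leftLim t))

theorem leftLim_congr {g h : ℝ≥0 → ℝ} (hg : IsCadlag g) {t : ℝ≥0} (ht : 0 < t)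
    (hgh : ∀ s < t, g s = h s) : Function.leftLim h t = Function.leftLim g t :=
  IsCadlag.leftLim_eq ht ((hg.tendsto_leftLim t).congr' (by
    filter_upwards [self_mem_nhdsWithin] with s hs using hgh s hs))

theorem IsCadlag.mem_leftLim {g : ℝ≥0 → ℝ} (hg : IsCadlag g) {S : Set ℝ} (hS : IsClosed S)
    {t : ℝ≥0} (h0 : g 0 ∈ S) (h : ∀ s < t, g s ∈ S) : Function.leftLim g t ∈ S := by
  rcases eq_or_ne t 0 with rfl | ht
  · rwa [leftLim_zero]
  · have := neBot_nhdsLT (pos_iff_ne_zero.2 ht)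
    exact hS.mem_of_tendsto (hg.tendsto_leftLim t) (by
      filter_upwards [self_mem_nhdsWithin] with s hs using h s hs)

/-- The one-sided limits bound `g` near each point; compactness of `[0,T]` makes the bound uniform.
-/
theorem IsCadlag.exists_bound {g : ℝ≥0 → ℝ} (hg : IsCadlag g) (T : ℝ≥0) :
    ∃ C, 0 ≤ C ∧ ∀ t ≤ T, |g t| ≤ C := by
  have key : ∃ C, ∀ t ∈ Iic T, |g t| ≤ C := by
    have hc : IsCompact (Iic T) := by
      rw [← Icc_bot]; exact isCompact_Icc
    refine hc.induction_on (p := fun S => ∃ C, ∀ t ∈ S, |g t| ≤ C) ⟨0, by simp⟩ ?_ ?_ ?_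
    · rintro s t hst ⟨C, hC⟩
      exact ⟨C, fun r hr => hC r (hst hr)⟩
    · rintro s t ⟨C, hC⟩ ⟨C', hC'⟩
      refine ⟨max C C', fun r hr => ?_⟩
      rcases hr with hr | hr
      · exact (hC r hr).trans (le_max_left _ _)
      · exact (hC' r hr).trans (le_max_right _ _)
    · intro t _
      have h1 : ∀ᶠ s in 𝓝[<] t, |g s| < |Function.leftLim g t| + 1 :=
        (hg.tendsto_leftLim t).abs.eventually_lt_const (lt_add_one _)
      have h2 : ∀ᶠ s in 𝓝[≥] t, |g s| < |g t| + 1 :=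
        ((hg t).1.tendsto.abs).eventually_lt_const (lt_add_one _)
      have h3 : ∀ᶠ s in 𝓝 t, |g s| ≤ max (|Function.leftLim g t| + 1) (|g t| + 1) := by
        rw [← nhdsLT_sup_nhdsGE, eventually_sup]
        exact ⟨h1.mono fun s hs => hs.le.trans (le_max_left _ _),
          h2.mono fun s hs => hs.le.trans (le_max_right _ _)⟩
      exact ⟨_, mem_nhdsWithin_of_mem_nhds h3, _, fun s hs => hs⟩
  obtain ⟨C, hC⟩ := key
  exact ⟨max C 0, le_max_right _ _, fun t ht => (hC t ht).trans (le_max_left _ _)⟩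

theorem IsCadlag.abs_leftLim_le {g : ℝ≥0 → ℝ} (hg : IsCadlag g) {T : ℝ≥0} {C : ℝ}
    (hC : ∀ t ≤ T, |g t| ≤ C) {t : ℝ≥0} (ht : t ≤ T) : |Function.leftLim g t| ≤ C := by
  have : Function.leftLim g t ∈ {x : ℝ | |x| ≤ C} :=
    hg.mem_leftLim (isClosed_le continuous_abs continuous_const) (hC 0 zero_le)
      fun s hs => hC s (hs.le.trans ht)
  exact this

/-- The largest multiple of `1 / (k + 1)` strictly below `s` (or `0`). -/
def gridBelow (k : ℕ) (s : ℝ≥0) : ℝ≥0 := ((⌈s * (k + 1)⌉₊ - 1 : ℕ) : ℝ≥0) / (k + 1)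

/-- The smallest multiple of `1 / (k + 1)` strictly above `s`. -/
def gridAbove (k : ℕ) (s : ℝ≥0) : ℝ≥0 := ((⌊s * (k + 1)⌋₊ + 1 : ℕ) : ℝ≥0) / (k + 1)

theorem gridBelow_lt {k : ℕ} {s : ℝ≥0} (hs : 0 < s) : gridBelow k s < s := by
  have hk : (0 : ℝ≥0) < k + 1 := by positivity
  rw [gridBelow, div_lt_iff₀ hk]
  have h1 : 0 < ⌈s * (k + 1)⌉₊ := Nat.ceil_pos.2 (by positivity)
  exact Nat.lt_ceil.1 (by omega)

theorem gridBelow_le (k : ℕ) (s : ℝ≥0) : gridBelow k s ≤ s := by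
  rcases eq_or_ne s 0 with rfl | hs
  · simp [gridBelow]
  · exact (gridBelow_lt (pos_iff_ne_zero.2 hs)).le

theorem le_gridBelow_add (k : ℕ) (s : ℝ≥0) : s ≤ gridBelow k s + 1 / (k + 1) := by
  have hk : (0 : ℝ≥0) < k + 1 := by positivity
  rw [gridBelow, ← add_div, le_div_iff₀ hk]
  refine (Nat.le_ceil _).trans ?_
  exact_mod_cast (by omega : ⌈s * (k + 1)⌉₊ ≤ ⌈s * (k + 1)⌉₊ - 1 + 1)

theorem lt_gridAbove (k : ℕ) (s : ℝ≥0) : s < gridAbove k s := by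
  have hk : (0 : ℝ≥0) < k + 1 := by positivity
  rw [gridAbove, lt_div_iff₀ hk]
  exact_mod_cast Nat.lt_floor_add_one (s * (k + 1))

theorem gridAbove_le (k : ℕ) (s : ℝ≥0) : gridAbove k s ≤ s + 1 / (k + 1) := by
  have hk : (0 : ℝ≥0) < k + 1 := by positivity
  rw [gridAbove, div_le_iff₀ hk, add_mul, one_div, inv_mul_cancel₀ hk.ne']
  push_cast
  gcongr
  exact Nat.floor_le zero_le

theorem tendsto_one_div_add_one_nnreal :
    Tendsto (fun k : ℕ => (1 : ℝ≥0) / (k + 1)) atTop (𝓝 0) := by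
  rw [← NNReal.tendsto_coe]
  simpa using tendsto_one_div_add_atTop_nhds_zero_nat (𝕜 := ℝ)

theorem tendsto_gridBelow {s : ℝ≥0} (hs : 0 < s) :
    Tendsto (fun k => gridBelow k s) atTop (𝓝[<] s) := by
  refine tendsto_nhdsWithin_iff.2 ⟨?_, .of_forall fun k => gridBelow_lt hs⟩
  refine tendsto_of_tendsto_of_tendsto_of_le_of_le (g := fun k : ℕ => s - 1 / (k + 1))
    ?_ tendsto_const_nhds (fun k => ?_) fun k => gridBelow_le k s
  · simpa using (tendsto_const_nhds (x := s)).sub tendsto_one_div_add_one_nnreal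
  · exact tsub_le_iff_right.2 (le_gridBelow_add k s)

theorem tendsto_gridAbove (s : ℝ≥0) : Tendsto (fun k => gridAbove k s) atTop (𝓝[≥] s) := by
  refine tendsto_nhdsWithin_iff.2 ⟨?_, .of_forall fun k => (lt_gridAbove k s).le⟩
  refine tendsto_of_tendsto_of_tendsto_of_le_of_le (h := fun k : ℕ => s + 1 / (k + 1))
    tendsto_const_nhds ?_ (fun k => (lt_gridAbove k s).le) fun k => gridAbove_le k s
  simpa using (tendsto_const_nhds (x := s)).add tendsto_one_div_add_one_nnreal

theorem IsCadlag.tendsto_gridBelow {g : ℝ≥0 → ℝ} (hg : IsCadlag g) (s : ℝ≥0) :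
    Tendsto (fun k => g (gridBelow k s)) atTop (𝓝 (Function.leftLim g s)) := by
  rcases eq_or_ne s 0 with rfl | hs
  · simp [gridBelow, leftLim_zero]
  · exact (hg.tendsto_leftLim s).comp (Reinsurance.tendsto_gridBelow (pos_iff_ne_zero.2 hs))

theorem measurable_floor_mul (k : ℕ) : Measurable fun s : ℝ≥0 => ⌊s * (k + 1)⌋₊ :=
  Nat.measurable_floor.comp (measurable_id.mul_const ((k : ℝ≥0) + 1))

theorem measurable_ceil_mul (k : ℕ) : Measurable fun s : ℝ≥0 => ⌈s * (k + 1)⌉₊ :=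
  Nat.measurable_ceil.comp (measurable_id.mul_const ((k : ℝ≥0) + 1))

/-- By right-continuity `g` is the pointwise limit of its values at grid points above, and each
approximation factors through a countable set. Left limits are handled in the same way with grid
points strictly below. -/
theorem IsCadlag.measurable {g : ℝ≥0 → ℝ} (hg : IsCadlag g) : Measurable g := by
  refine measurable_of_tendsto_metrizable (f := fun k s => g (gridAbove k s)) (fun k => ?_)
    (tendsto_pi_nhds.2 fun s => (hg s).1.tendsto.comp (tendsto_gridAbove s))
  have h1 : Measurable (fun n : ℕ => g (((n + 1 : ℕ) : ℝ≥0) / (k + 1))) := measurable_from_top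
  have h2 := h1.comp (measurable_floor_mul k)
  simp only [Function.comp_def] at h2
  simpa only [gridAbove] using h2

theorem IsCadlag.measurable_leftLim {g : ℝ≥0 → ℝ} (hg : IsCadlag g) :
    Measurable (Function.leftLim g) := by
  refine measurable_of_tendsto_metrizable (f := fun k s => g (gridBelow k s)) (fun k => ?_)
    (tendsto_pi_nhds.2 fun s => hg.tendsto_gridBelow s)
  have : Measurable (fun n : ℕ => g (((n - 1 : ℕ) : ℝ≥0) / (k + 1))) := measurable_from_top
  exact this.comp (measurable_ceil_mul k)

/-- Joint measurability in time and `ω` from values of `D` at times up to `t` only; this makes it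
usable with `m` the σ-algebra at time `t` of a filtration. -/
theorem measurable_leftLim_comp {Ω : Type*} {m : MeasurableSpace Ω} {D : ℝ≥0 → Ω → ℝ}
    (hD : ∀ ω, IsCadlag fun s => D s ω) {φ : ℝ≥0 → ℝ≥0} (hφ : Measurable φ) {t : ℝ≥0}
    (hφt : ∀ s, φ s ≤ t) (hm : ∀ r ≤ t, Measurable (D r)) :
    Measurable fun p : ℝ≥0 × Ω => Function.leftLim (fun s => D s p.2) (φ p.1) := by
  refine measurable_of_tendsto_metrizable (f := fun k p => D (gridBelow k (φ p.1)) p.2)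
    (fun k => ?_) (tendsto_pi_nhds.2 ?_)
  swap
  · intro p
    have h := (hD p.2).tendsto_gridBelow (φ p.1)
    exact h
  have h1 : Measurable (fun q : ℕ × Ω => D (min (((q.1 - 1 : ℕ) : ℝ≥0) / (k + 1)) t) q.2) :=
    measurable_from_prod_countable_right fun n =>
      hm (min (((n - 1 : ℕ) : ℝ≥0) / (k + 1)) t) (min_le_right _ _)
  have h2 : Measurable (fun p : ℝ≥0 × Ω => (⌈φ p.1 * (k + 1)⌉₊, p.2)) :=
    ((measurable_ceil_mul k).comp (hφ.comp measurable_fst)).prodMk measurable_snd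
  convert h1.comp h2 using 2 with p
  simp only [Function.comp_apply]
  have e := min_eq_left ((gridBelow_le k (φ p.1)).trans (hφt _))
  rw [gridBelow] at e ⊢
  rw [e]

/-! ### Lebesgue measure on the half-line -/

theorem timeMeasure_apply {S : Set ℝ≥0} (hS : MeasurableSet S) :
    timeMeasure S = volume (Real.toNNReal ⁻¹' S ∩ Ici 0) := by
  rw [timeMeasure, Measure.map_apply measurable_real_toNNReal hS,
    Measure.restrict_apply (measurable_real_toNNReal hS)]

theorem timeMeasure_Icc (s t : ℝ≥0) : timeMeasure (Icc s t) = ENNReal.ofReal (t - s) := by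
  rw [timeMeasure_apply measurableSet_Icc]
  have : Real.toNNReal ⁻¹' Icc s t ∩ Ici 0 = Icc (s : ℝ) t := by
    ext x
    simp only [mem_inter_iff, mem_preimage, mem_Icc, mem_Ici]
    constructor
    · rintro ⟨⟨h1, h2⟩, h3⟩
      exact ⟨(Real.le_toNNReal_iff_coe_le h3).1 h1, Real.toNNReal_le_iff_le_coe.1 h2⟩
    · rintro ⟨h1, h2⟩
      have h3 : 0 ≤ x := s.2.trans h1
      exact ⟨⟨(Real.le_toNNReal_iff_coe_le h3).2 h1, Real.toNNReal_le_iff_le_coe.2 h2⟩, h3⟩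
  rw [this, Real.volume_Icc]

instance : NullSingletonClass timeMeasure :=
  ⟨fun t => by rw [← Icc_self, timeMeasure_Icc]; simp⟩

theorem timeMeasure_Ioc (s t : ℝ≥0) : timeMeasure (Ioc s t) = ENNReal.ofReal (t - s) := by
  rw [← timeMeasure_Icc]; exact measure_congr Ioc_ae_eq_Icc

theorem timeMeasure_Iic (t : ℝ≥0) : timeMeasure (Iic t) = t := by
  rw [← Icc_bot, timeMeasure_Icc]; simp

instance : SFinite timeMeasure := by
  unfold timeMeasure; infer_instance

theorem timeMeasure_Iic_lt_top (t : ℝ≥0) : timeMeasure (Iic t) < ∞ := by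
  rw [timeMeasure_Iic]; exact ENNReal.coe_lt_top

theorem timeMeasure_real_Ioc {s t : ℝ≥0} (hst : s ≤ t) : timeMeasure.real (Ioc s t) = t - s := by
  rw [measureReal_def, timeMeasure_Ioc, ENNReal.toReal_ofReal (by simpa using hst)]

/-- The map `π` lets one statement serve integrals over time (`π = id`) and over marked claims (`π =
Prod.fst`). -/
theorem setIntegral_Iic_sub {E : Type*} [MeasurableSpace E] {κ : Measure E} {h : E → ℝ}
    {π : E → ℝ≥0} (hπ : Measurable π) {s t : ℝ≥0} (hst : s ≤ t)
    (hi : IntegrableOn h (π ⁻¹' Iic t) κ) :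
    (∫ z in π ⁻¹' Iic t, h z ∂κ) - ∫ z in π ⁻¹' Iic s, h z ∂κ = ∫ z in π ⁻¹' Ioc s t, h z ∂κ := by
  have h1 : π ⁻¹' Iic t = π ⁻¹' Iic s ∪ π ⁻¹' Ioc s t := by
    rw [← preimage_union, Iic_union_Ioc_eq_Iic hst]
  have hd : Disjoint (π ⁻¹' Iic s) (π ⁻¹' Ioc s t) :=
    (Iic_disjoint_Ioc le_rfl).preimage π
  rw [h1] at hi ⊢
  rw [setIntegral_union hd (hπ measurableSet_Ioc) hi.left_of_union hi.right_of_union]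
  ring

theorem integrableOn_of_bound {E : Type*} [MeasurableSpace E] {κ : Measure E} {h : E → ℝ}
    (hm : Measurable h) {S : Set E} (hS : MeasurableSet S) (hκ : κ S < ∞) {C : ℝ}
    (hC : ∀ z ∈ S, |h z| ≤ C) : IntegrableOn h S κ :=
  Measure.integrableOn_of_bounded hκ.ne hm.aestronglyMeasurable
    ((ae_restrict_iff' hS).2 (.of_forall hC))

/-! ### The exponential of an integral -/

section Exponential

variable {g : ℝ≥0 → ℝ} {C : ℝ}

/-- The primitive `∫₀ᵗ g`. -/
def primitive (g : ℝ≥0 → ℝ) (t : ℝ≥0) : ℝ := ∫ s in Iic t, g s ∂timeMeasure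

theorem setIntegral_time_zero (g : ℝ≥0 → ℝ) : ∫ s in Iic 0, g s ∂timeMeasure = 0 := by
  have h : Iic (0 : ℝ≥0) = {0} := by ext; simp
  rw [h]
  exact setIntegral_measure_zero _ (measure_singleton _)

theorem integrableOn_time (hg : Measurable g) {T : ℝ≥0} (hC : ∀ t ≤ T, |g t| ≤ C) :
    IntegrableOn g (Iic T) timeMeasure :=
  integrableOn_of_bound hg measurableSet_Iic (timeMeasure_Iic_lt_top T) hC

theorem setIntegral_time_sub (hg : Measurable g) {s t : ℝ≥0} (hst : s ≤ t)
    (hC : ∀ r ≤ t, |g r| ≤ C) :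
    (∫ r in Iic t, g r ∂timeMeasure) - ∫ r in Iic s, g r ∂timeMeasure
      = ∫ r in Ioc s t, g r ∂timeMeasure :=
  setIntegral_Iic_sub measurable_id hst (integrableOn_time hg hC)

theorem abs_setIntegral_time_le {s t : ℝ≥0} (hst : s ≤ t) (hC : ∀ r ∈ Ioc s t, |g r| ≤ C) :
    |∫ r in Ioc s t, g r ∂timeMeasure| ≤ C * (t - s) := by
  rw [← timeMeasure_real_Ioc hst]
  exact norm_setIntegral_le_of_norm_le_const (f := g)
    ((timeMeasure_Ioc s t).trans_lt ENNReal.ofReal_lt_top) hC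

theorem le_setIntegral_time (hg : Measurable g) {s t : ℝ≥0} (hst : s ≤ t) {c : ℝ}
    (hC : ∀ r ≤ t, |g r| ≤ C) (hc : ∀ r ∈ Ioc s t, c ≤ g r) :
    c * (t - s) ≤ ∫ r in Ioc s t, g r ∂timeMeasure := by
  rw [← timeMeasure_real_Ioc hst, mul_comm, ← smul_eq_mul, ← setIntegral_const]
  refine setIntegral_mono_on (integrableOn_const (by rw [timeMeasure_Ioc]; simp))
    ((integrableOn_time hg hC).mono_set Ioc_subset_Iic_self) measurableSet_Ioc hc

variable (hg : Measurable g) (h0 : ∀ s, 0 ≤ g s) (hC : ∀ s, g s ≤ C)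
include hg h0 hC

theorem primitive_sub {s t : ℝ≥0} (hst : s ≤ t) :
    primitive g t - primitive g s = ∫ r in Ioc s t, g r ∂timeMeasure :=
  setIntegral_time_sub hg hst fun r _ => by rw [abs_of_nonneg (h0 r)]; exact hC r

theorem primitive_mono : Monotone (primitive g) := fun s t hst => by
  have h := primitive_sub hg h0 hC hst
  have : 0 ≤ ∫ r in Ioc s t, g r ∂timeMeasure := integral_nonneg fun r => h0 r
  linarith

theorem primitive_sub_le {s t : ℝ≥0} (hst : s ≤ t) :
    primitive g t - primitive g s ≤ C * (t - s) := by
  rw [primitive_sub hg h0 hC hst]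
  exact (le_abs_self _).trans (abs_setIntegral_time_le hst fun r _ => by
    rw [abs_of_nonneg (h0 r)]; exact hC r)

theorem continuous_primitive : Continuous (primitive g) := by
  have hC0 : 0 ≤ C := (h0 0).trans (hC 0)
  have : LipschitzWith C.toNNReal (primitive g) := by
    refine LipschitzWith.of_le_add_mul _ fun s t => ?_
    rw [Real.coe_toNNReal _ hC0, NNReal.dist_eq]
    rcases le_total s t with hst | hst
    · have := primitive_mono hg h0 hC hst
      have : 0 ≤ C * |(s : ℝ) - t| := by positivity
      linarith
    · have h1 := primitive_sub_le hg h0 hC hst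
      have h2 : C * (s - t) ≤ C * |(s : ℝ) - t| := by gcongr; exact le_abs_self _
      linarith
  exact this.continuous

theorem abs_mul_exp_primitive_le {T t : ℝ≥0} (ht : t ≤ T) :
    |g t * Real.exp (primitive g t)| ≤ C * Real.exp (primitive g T) := by
  have hC0 : 0 ≤ C := (h0 0).trans (hC 0)
  rw [abs_of_nonneg (mul_nonneg (h0 t) (Real.exp_pos _).le)]
  exact mul_le_mul (hC t) (Real.exp_le_exp.2 (primitive_mono hg h0 hC ht))
    (Real.exp_pos _).le hC0

theorem measurable_mul_exp_primitive : Measurable fun r => g r * Real.exp (primitive g r) :=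
  hg.mul (Real.measurable_exp.comp (continuous_primitive hg h0 hC).measurable)

/-- With `A` the primitive, both quantities compared lie between `exp (A s) * (A t - A s)` and `exp
(A t) * (A t - A s)`. Their distance is thus at most a product of two increments, each of order `t -
s`. -/
theorem abs_exp_primitive_sub_sub_le {s t : ℝ≥0} (hst : s ≤ t) :
    |Real.exp (primitive g t) - Real.exp (primitive g s)
      - ∫ r in Ioc s t, g r * Real.exp (primitive g r) ∂timeMeasure|
      ≤ Real.exp (primitive g t) * C ^ 2 * (t - s) ^ 2 := by
  set A := primitive g
  have hmono := primitive_mono hg h0 hC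
  have hle := primitive_sub_le hg h0 hC hst
  have hAst : A s ≤ A t := hmono hst
  have hEst : Real.exp (A s) ≤ Real.exp (A t) := Real.exp_le_exp.2 hAst
  have hts : (s : ℝ) ≤ t := by exact_mod_cast hst
  have hlow : Real.exp (A s) * (A t - A s)
      ≤ ∫ r in Ioc s t, g r * Real.exp (A r) ∂timeMeasure := by
    rw [primitive_sub hg h0 hC hst, ← integral_const_mul]
    refine setIntegral_mono_on ?_ ?_ measurableSet_Ioc fun r hr => ?_
    · exact ((integrableOn_time (C := C) hg fun r _ => by
        rw [abs_of_nonneg (h0 r)]; exact hC r).mono_set Ioc_subset_Iic_self).const_mul _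
    · exact (integrableOn_time (measurable_mul_exp_primitive hg h0 hC) fun r hr =>
        abs_mul_exp_primitive_le hg h0 hC hr).mono_set Ioc_subset_Iic_self
    · rw [mul_comm]
      exact mul_le_mul_of_nonneg_left (Real.exp_le_exp.2 (hmono hr.1.le)) (h0 r)
  have hupp : ∫ r in Ioc s t, g r * Real.exp (A r) ∂timeMeasure
      ≤ Real.exp (A t) * (A t - A s) := by
    rw [primitive_sub hg h0 hC hst, ← integral_const_mul]
    refine setIntegral_mono_on ?_ ?_ measurableSet_Ioc fun r hr => ?_
    · exact (integrableOn_time (measurable_mul_exp_primitive hg h0 hC) fun r hr =>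
        abs_mul_exp_primitive_le hg h0 hC hr).mono_set Ioc_subset_Iic_self
    · exact ((integrableOn_time (C := C) hg fun r _ => by
        rw [abs_of_nonneg (h0 r)]; exact hC r).mono_set Ioc_subset_Iic_self).const_mul _
    · rw [mul_comm (Real.exp (A t))]
      exact mul_le_mul_of_nonneg_left (Real.exp_le_exp.2 (hmono hr.2)) (h0 r)
  have e1 : Real.exp (A s) * (A t - A s) ≤ Real.exp (A t) - Real.exp (A s) := by
    have h := Real.add_one_le_exp (A t - A s)
    have h2 : Real.exp (A t) = Real.exp (A s) * Real.exp (A t - A s) := by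
      rw [← Real.exp_add]; ring_nf
    rw [h2]
    nlinarith [Real.exp_pos (A s)]
  have e2 : Real.exp (A t) - Real.exp (A s) ≤ Real.exp (A t) * (A t - A s) := by
    have h := Real.add_one_le_exp (A s - A t)
    have h2 : Real.exp (A s) = Real.exp (A t) * Real.exp (A s - A t) := by
      rw [← Real.exp_add]; ring_nf
    rw [h2]
    nlinarith [Real.exp_pos (A t)]
  have hd : 0 ≤ A t - A s := by linarith
  calc _ ≤ (Real.exp (A t) - Real.exp (A s)) * (A t - A s) := by
        rw [abs_le]; constructor <;> linarith
    _ ≤ Real.exp (A t) * (A t - A s) * (A t - A s) := by gcongr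
    _ = Real.exp (A t) * (A t - A s) ^ 2 := by ring
    _ ≤ Real.exp (A t) * (C * (t - s)) ^ 2 := by gcongr
    _ = _ := by ring

/-- As `g` is only measurable, the chain rule is not available pointwise. The difference of the two
sides, as a function of time, instead has increments of quadratic order; its derivative vanishes and
it is constant. -/
theorem exp_primitive_sub_exp_primitive {s t : ℝ≥0} (hst : s ≤ t) :
    Real.exp (primitive g t) - Real.exp (primitive g s)
      = ∫ r in Ioc s t, g r * Real.exp (primitive g r) ∂timeMeasure := by
  set φ : ℝ≥0 → ℝ := fun r => Real.exp (primitive g r)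
    - ∫ r in Iic r, g r * Real.exp (primitive g r) ∂timeMeasure with hφ
  set K := Real.exp (primitive g t) * C ^ 2
  have hK0 : 0 ≤ K := by positivity
  have hint : ∀ {r q : ℝ≥0}, r ≤ q →
      (∫ r in Iic q, g r * Real.exp (primitive g r) ∂timeMeasure)
        - ∫ r in Iic r, g r * Real.exp (primitive g r) ∂timeMeasure
      = ∫ r in Ioc r q, g r * Real.exp (primitive g r) ∂timeMeasure := fun hrq =>
    setIntegral_time_sub (measurable_mul_exp_primitive hg h0 hC) hrq fun r hr =>
      abs_mul_exp_primitive_le hg h0 hC hr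
  have hK : ∀ r q : ℝ≥0, r ≤ q → q ≤ t → |φ q - φ r| ≤ K * ((q : ℝ) - r) ^ 2 := by
    intro r q hrq hqt
    have h := abs_exp_primitive_sub_sub_le hg h0 hC hrq
    have hE : Real.exp (primitive g q) ≤ Real.exp (primitive g t) :=
      Real.exp_le_exp.2 (primitive_mono hg h0 hC hqt)
    rw [← hint hrq] at h
    calc _ = _ := by rw [hφ]; ring_nf
      _ ≤ _ := h
      _ ≤ K * ((q : ℝ) - r) ^ 2 := by
        refine mul_le_mul_of_nonneg_right ?_ (sq_nonneg _)
        exact mul_le_mul_of_nonneg_right hE (sq_nonneg _)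
  have hψ : ∀ x ∈ Icc (s : ℝ) t, ∀ y ∈ Icc (s : ℝ) t,
      |φ y.toNNReal - φ x.toNNReal| ≤ K * (y - x) ^ 2 := by
    have aux : ∀ x ∈ Icc (s : ℝ) t, ∀ y ∈ Icc (s : ℝ) t, x ≤ y →
        |φ y.toNNReal - φ x.toNNReal| ≤ K * (y - x) ^ 2 := by
      intro x hx y hy hxy
      have h := hK x.toNNReal y.toNNReal (Real.toNNReal_le_toNNReal hxy)
        (Real.toNNReal_le_iff_le_coe.2 hy.2)
      rwa [Real.coe_toNNReal _ (s.2.trans hx.1), Real.coe_toNNReal _ (s.2.trans hy.1)] at h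
    intro x hx y hy
    rcases le_total x y with h | h
    · exact aux x hx y hy h
    · rw [abs_sub_comm, ← neg_sub x y, neg_sq]
      exact aux y hy x hx h
  have hlim : ∀ x : ℝ, Tendsto (fun y => K * (y - x) ^ 2) (𝓝 x) (𝓝 0) := fun x => by
    have : Continuous fun y => K * (y - x) ^ 2 := by fun_prop
    simpa using this.tendsto x
  have hconst := constant_of_has_deriv_right_zero (f := fun x : ℝ => φ x.toNNReal)
    (a := s) (b := t) ?_ ?_ t ⟨by exact_mod_cast hst, le_rfl⟩
  · simp only [Real.toNNReal_coe, hφ] at hconst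
    rw [← hint hst]
    linarith
  · intro x hx
    refine tendsto_iff_dist_tendsto_zero.2 ?_
    refine squeeze_zero' (.of_forall fun _ => dist_nonneg) ?_
      ((hlim x).mono_left nhdsWithin_le_nhds)
    filter_upwards [self_mem_nhdsWithin] with y hy using hψ x hx y hy
  · intro x hx
    rw [hasDerivWithinAt_iff_isLittleO]
    refine Asymptotics.isLittleO_iff.2 fun c hc => ?_
    have hlim2 : ∀ᶠ y in 𝓝[≥] x, K * |y - x| < c := by
      have : Continuous fun y => K * |y - x| := by fun_prop
      have h := this.tendsto x
      simp only [sub_self, abs_zero, mul_zero] at h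
      exact (h.mono_left nhdsWithin_le_nhds).eventually_lt_const hc
    have hmem : ∀ᶠ y in 𝓝[≥] x, y ∈ Icc x (t : ℝ) := Icc_mem_nhdsGE hx.2
    filter_upwards [hlim2, hmem] with y hy1 hy2
    have h := hψ x ⟨hx.1, hx.2.le⟩ y ⟨hx.1.trans hy2.1, hy2.2⟩
    simp only [smul_zero, sub_zero, Real.norm_eq_abs]
    refine h.trans ?_
    rw [← sq_abs, sq, ← mul_assoc]
    gcongr

end Exponential

/-! ### Realizations of the claims -/

/-- A realization of the marked claim times: locally finitely many claims in time, no two claims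
at the same time, and none at time `0`. -/
structure IsClaimPath (κ : Measure (ℝ≥0 × ℝ)) : Prop where
  finite : ∀ t, κ (Prod.fst ⁻¹' Iic t) < ∞
  integerValued : ∀ A, MeasurableSet A → ∃ n : ℕ∞, κ A = (n : ℝ≥0∞)
  simple : ∀ t, κ (Prod.fst ⁻¹' {t}) ≤ 1
  zero : κ (Prod.fst ⁻¹' {0}) = 0

/-- The number of claims up to time `t`. -/
def claimCount (κ : Measure (ℝ≥0 × ℝ)) (t : ℝ≥0) : ℕ := ⌊(κ (Prod.fst ⁻¹' Iic t)).toReal⌋₊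

namespace IsClaimPath

variable {κ : Measure (ℝ≥0 × ℝ)} (hκ : IsClaimPath κ)
include hκ

theorem eq_zero_of_lt_one {A : Set (ℝ≥0 × ℝ)} (hA : MeasurableSet A) (h : κ A < 1) : κ A = 0 := by
  obtain ⟨n, hn⟩ := hκ.integerValued A hA
  rw [hn] at h ⊢
  have : n < 1 := by exact_mod_cast h
  have : n = 0 := by
    exact Order.lt_one_iff.1 this
  simp [this]

theorem measure_Iic (t : ℝ≥0) : κ (Prod.fst ⁻¹' Iic t) = claimCount κ t := by
  obtain ⟨n, hn⟩ := hκ.integerValued _ (measurable_fst measurableSet_Iic : MeasurableSet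
    (Prod.fst ⁻¹' Iic t : Set (ℝ≥0 × ℝ)))
  have hfin := hκ.finite t
  rw [claimCount, hn] at *
  induction n with
  | top => simp at hfin
  | coe n => simp

/-- By continuity from above the masses tend to `0`, and an integer below `1` is `0`. This isolates
claims on both sides of any time. -/
theorem exists_null_of_antitone {S : ℕ → Set ℝ≥0} (hS : ∀ k, MeasurableSet (S k))
    (hanti : Antitone S) {T : ℝ≥0} (hT : S 0 ⊆ Iic T) (hempty : ⋂ k, S k = ∅) :
    ∃ k, κ (Prod.fst ⁻¹' S k) = 0 := by
  have h := tendsto_measure_iInter_atTop (μ := κ) (s := fun k => Prod.fst ⁻¹' S k)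
    (fun k => (measurable_fst (hS k)).nullMeasurableSet) (fun i j hij => preimage_mono (hanti hij))
    ⟨0, ((measure_mono (preimage_mono hT)).trans_lt (hκ.finite T)).ne⟩
  rw [← preimage_iInter, hempty, preimage_empty, measure_empty] at h
  obtain ⟨k, hk⟩ := (h.eventually_lt_const one_pos).exists
  exact ⟨k, hκ.eq_zero_of_lt_one (measurable_fst (hS k)) hk⟩

theorem exists_null_right (t : ℝ≥0) : ∃ s > t, κ (Prod.fst ⁻¹' Ioc t s) = 0 := by
  suffices h : ∃ k : ℕ, κ (Prod.fst ⁻¹' Ioc t (t + 1 / (k + 1))) = 0 by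
    obtain ⟨k, hk⟩ := h
    exact ⟨_, lt_add_of_pos_right _ (by positivity), hk⟩
  refine hκ.exists_null_of_antitone (T := t + 1) (fun k => measurableSet_Ioc) ?_ ?_ ?_
  · intro i j hij
    refine Ioc_subset_Ioc_right ?_
    gcongr
  · exact fun x hx => by simpa using hx.2
  · refine eq_empty_of_forall_notMem fun x hx => ?_
    rw [mem_iInter] at hx
    have h1 : x ≤ t + 0 := ge_of_tendsto
      (tendsto_const_nhds.add tendsto_one_div_add_one_nnreal) (.of_forall fun k => (hx k).2)
    rw [add_zero] at h1
    exact absurd (hx 0).1 h1.not_gt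

theorem exists_null_left {t : ℝ≥0} (ht : 0 < t) : ∃ s < t, κ (Prod.fst ⁻¹' Ioo s t) = 0 := by
  suffices h : ∃ k : ℕ, κ (Prod.fst ⁻¹' Ioo (t - 1 / (k + 1)) t) = 0 by
    obtain ⟨k, hk⟩ := h
    exact ⟨_, tsub_lt_self ht (by positivity), hk⟩
  refine hκ.exists_null_of_antitone (T := t) (fun k => measurableSet_Ioo) ?_ ?_ ?_
  · intro i j hij
    refine Ioo_subset_Ioo_left ?_
    gcongr
  · exact fun x hx => hx.2.le
  · refine eq_empty_of_forall_notMem fun x hx => ?_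
    rw [mem_iInter] at hx
    have h1 : t - 0 ≤ x := le_of_tendsto
      (tendsto_const_nhds.sub tendsto_one_div_add_one_nnreal) (.of_forall fun k => (hx k).1.le)
    rw [tsub_zero] at h1
    exact absurd (hx 0).2 h1.not_gt

theorem ae_pos : ∀ᵐ z ∂κ, 0 < z.1 := by
  rw [ae_iff]
  refine measure_mono_null (fun z hz => ?_) hκ.zero
  simpa using hz

omit hκ in
/-- The set of times in `[0,t]` after which (inclusively) no claim arrives before `t` is null. -/
theorem ae_measure_Icc_ne_zero (t : ℝ≥0) :
    ∀ᵐ z ∂κ, z.1 ≤ t → κ (Prod.fst ⁻¹' Icc z.1 t) ≠ 0 := by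
  set S : Set ℝ≥0 := {s | s ≤ t ∧ κ (Prod.fst ⁻¹' Icc s t) = 0} with hS
  suffices h : κ (Prod.fst ⁻¹' S) = 0 by
    rw [ae_iff]
    refine measure_mono_null (fun z hz => ?_) h
    simpa [hS] using hz
  rcases S.eq_empty_or_nonempty with he | hne
  · simp [he]
  obtain ⟨v, -, hvlim, hvS⟩ := exists_seq_tendsto_sInf hne (OrderBot.bddBelow S)
  -- If nonempty, `S` is an interval ending at `t`, so countably many null intervals cover it, its
  -- infimum being treated separately when it belongs to `S`.
  have hcover : S ⊆ (⋃ (_ : sInf S ∈ S), Icc (sInf S) t) ∪ ⋃ k, Icc (v k) t := by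
    intro s hs
    rcases (csInf_le (OrderBot.bddBelow S) hs).eq_or_lt with h | h
    · left
      simp only [mem_iUnion]
      rw [h]
      exact ⟨hs, le_rfl, hs.1⟩
    · right
      obtain ⟨k, hk⟩ := (hvlim.eventually_lt_const h).exists
      exact mem_iUnion.2 ⟨k, hk.le, hs.1⟩
  refine measure_mono_null (preimage_mono hcover) ?_
  rw [preimage_union, measure_union_null_iff]
  constructor
  · by_cases h : sInf S ∈ S
    · simpa [h] using h.2
    · simp [h]
  · rw [preimage_iUnion, measure_iUnion_null_iff]
    exact fun k => (hvS k).2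

/-- Outside a null set of marks, `[z.1, t]` carries nonzero mass, hence at least one claim, which is
not counted at an earlier time `r`. The strict inequality drives the induction on the number of
claims. -/
theorem ae_claimCount_lt (t : ℝ≥0) :
    ∀ᵐ z ∂κ, z.1 ≤ t → ∀ r < z.1, claimCount κ r < claimCount κ t := by
  filter_upwards [ae_measure_Icc_ne_zero t] with z hz hzt r hr
  have hz := hz hzt
  have hmI : MeasurableSet (Prod.fst ⁻¹' Icc z.1 t : Set (ℝ≥0 × ℝ)) :=
    measurable_fst measurableSet_Icc
  have h1 : 1 ≤ κ (Prod.fst ⁻¹' Icc z.1 t) := by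
    by_contra h
    exact hz (hκ.eq_zero_of_lt_one hmI (not_le.1 h))
  have h2 : κ (Prod.fst ⁻¹' Iic r) + κ (Prod.fst ⁻¹' Icc z.1 t) ≤ κ (Prod.fst ⁻¹' Iic t) := by
    rw [← measure_union _ hmI, ← preimage_union]
    · refine measure_mono (preimage_mono (union_subset ?_ Icc_subset_Iic_self))
      exact Iic_subset_Iic.2 (hr.le.trans hzt)
    · refine Disjoint.preimage _ (disjoint_left.2 fun s hs hs' => ?_)
      exact absurd (hs'.1.trans hs) (not_le.2 hr)
  have h3 : (claimCount κ r : ℝ≥0∞) + 1 ≤ claimCount κ t := by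
    rw [← hκ.measure_Iic, ← hκ.measure_Iic]
    exact (add_le_add le_rfl h1).trans h2
  exact_mod_cast h3

theorem claimCount_mono : Monotone (claimCount κ) := fun s t hst => by
  have : (claimCount κ s : ℝ≥0∞) ≤ claimCount κ t := by
    rw [← hκ.measure_Iic, ← hκ.measure_Iic]
    exact measure_mono (preimage_mono (Iic_subset_Iic.2 hst))
  exact_mod_cast this

variable {h : ℝ≥0 × ℝ → ℝ}

omit hκ in
theorem integral_eq_of_null (hi : ∀ t, IntegrableOn h (Prod.fst ⁻¹' Iic t) κ)
    {s t : ℝ≥0} (hst : s ≤ t) (h0 : κ (Prod.fst ⁻¹' Ioc s t) = 0) :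
    ∫ z in Prod.fst ⁻¹' Iic t, h z ∂κ = ∫ z in Prod.fst ⁻¹' Iic s, h z ∂κ := by
  have := setIntegral_Iic_sub measurable_fst hst (hi t)
  rw [setIntegral_measure_zero _ h0] at this
  linarith

/-- Claims are isolated, so the integral is constant just after and just before each time. -/
theorem isCadlag_setIntegral (hi : ∀ t, IntegrableOn h (Prod.fst ⁻¹' Iic t) κ) :
    IsCadlag fun t => ∫ z in Prod.fst ⁻¹' Iic t, h z ∂κ := by
  intro t
  constructor
  · obtain ⟨s, hs, h0⟩ := hκ.exists_null_right t
    refine ContinuousWithinAt.congr_of_eventuallyEq (f := fun _ =>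
      ∫ z in Prod.fst ⁻¹' Iic t, h z ∂κ) continuousWithinAt_const ?_ rfl
    filter_upwards [Icc_mem_nhdsGE hs] with r hr
    exact integral_eq_of_null hi hr.1
      (measure_mono_null (preimage_mono (Ioc_subset_Ioc_right hr.2)) h0)
  · rcases eq_or_ne t 0 with rfl | ht
    · exact ⟨0, by simp⟩
    obtain ⟨s, hs, h0⟩ := hκ.exists_null_left (pos_iff_ne_zero.2 ht)
    refine ⟨∫ z in Prod.fst ⁻¹' Iic s, h z ∂κ, tendsto_const_nhds.congr' ?_⟩
    filter_upwards [Ioo_mem_nhdsLT hs] with r hr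
    exact (integral_eq_of_null hi hr.1.le (measure_mono_null (preimage_mono
      (Ioc_subset_Ioo_right hr.2)) h0)).symm

end IsClaimPath

/-! ### Comparison -/

section Comparison

variable {κ : Measure (ℝ≥0 × ℝ)} {g D : ℝ≥0 → ℝ} {j : ℝ≥0 × ℝ → ℝ} {C d : ℝ}

theorem increment_of_equation (hg : Measurable g) (h0 : ∀ s, 0 ≤ g s) (hC : ∀ s, g s ≤ C)
    (hD : IsCadlag D) (hj : ∀ t, IntegrableOn j (Prod.fst ⁻¹' Iic t) κ)
    (heq : ∀ t, D t = d + ∫ s in Iic t, D s * g s ∂timeMeasure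
      - ∫ z in Prod.fst ⁻¹' Iic t, j z ∂κ) {s t : ℝ≥0} (hst : s ≤ t) :
    D t - D s = ∫ r in Ioc s t, D r * g r ∂timeMeasure
      - ∫ z in Prod.fst ⁻¹' Ioc s t, j z ∂κ := by
  obtain ⟨K, hK0, hK⟩ := hD.exists_bound t
  rw [← setIntegral_Iic_sub measurable_fst hst (hj t),
    ← setIntegral_time_sub (C := K * C) (g := fun r => D r * g r) (hD.measurable.mul hg) hst, heq t, heq s]
  · ring
  · intro r hr
    rw [abs_mul, abs_of_nonneg (h0 r)]
    exact mul_le_mul (hK r hr) (hC r) (h0 r) hK0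

/-- A càdlàg solution of a linear equation with negative jumps no larger than its left limit
stays nonnegative. -/
theorem nonneg_of_equation (hκ : IsClaimPath κ) (hg : Measurable g) (h0 : ∀ s, 0 ≤ g s)
    (hC : ∀ s, g s ≤ C) (hD : IsCadlag D) (hd : 0 ≤ d)
    (hj : ∀ t, IntegrableOn j (Prod.fst ⁻¹' Iic t) κ)
    (hjle : ∀ᵐ z ∂κ, 0 ≤ Function.leftLim D z.1 → j z ≤ Function.leftLim D z.1)
    (heq : ∀ t, D t = d + ∫ s in Iic t, D s * g s ∂timeMeasure
      - ∫ z in Prod.fst ⁻¹' Iic t, j z ∂κ) (t : ℝ≥0) : 0 ≤ D t := by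
  have hC0 : 0 ≤ C := (h0 0).trans (hC 0)
  have hincr := fun {s t : ℝ≥0} (hst : s ≤ t) => increment_of_equation hg h0 hC hD hj heq hst
  by_contra hneg
  set S : Set ℝ≥0 := {s | D s < 0} with hS
  have hne : S.Nonempty := ⟨t, not_le.1 hneg⟩
  -- `D` is first shown to be nonnegative at the infimum `T` of its negative times, then on an
  -- interval to the right of `T`, which contradicts the choice of `T`.
  set T := sInf S with hT
  have hbelow : ∀ s < T, 0 ≤ D s := fun s hs => by
    by_contra h
    exact absurd (csInf_le (OrderBot.bddBelow S) (not_le.1 h : s ∈ S)) (not_le.2 hs)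
  have hDT : 0 ≤ D T := by
    rcases eq_or_ne T 0 with h | h
    · rw [h, heq 0, setIntegral_time_zero]
      have : Prod.fst ⁻¹' Iic (0 : ℝ≥0) = (Prod.fst ⁻¹' {0} : Set (ℝ≥0 × ℝ)) := by
        ext; simp
      rw [this, setIntegral_measure_zero _ hκ.zero]
      linarith
    have hTpos : 0 < T := pos_iff_ne_zero.2 h
    have hleft : 0 ≤ Function.leftLim D T :=
      hD.mem_leftLim isClosed_Ici (hbelow 0 hTpos) hbelow
    obtain ⟨s₀, hs₀, hnull⟩ := hκ.exists_null_left hTpos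
    have hbot := neBot_nhdsLT hTpos
    obtain ⟨K, hK0, hK⟩ := hD.exists_bound T
    -- Just before `T` there is no claim: as `s ↑ T` the drift over `(s, T]` vanishes and only the
    -- claim at `T` remains.
    have hjump : D T - Function.leftLim D T = - ∫ z in Prod.fst ⁻¹' {T}, j z ∂κ := by
      have hl1 : Tendsto (fun s => D T - D s) (𝓝[<] T) (𝓝 (D T - Function.leftLim D T)) :=
        tendsto_const_nhds.sub (hD.tendsto_leftLim T)
      refine tendsto_nhds_unique hl1 ?_
      have hev : ∀ᶠ s in 𝓝[<] T, (∫ r in Ioc s T, D r * g r ∂timeMeasure)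
          - ∫ z in Prod.fst ⁻¹' {T}, j z ∂κ = D T - D s := by
        filter_upwards [Ioo_mem_nhdsLT hs₀] with s hs
        rw [hincr hs.2.le]
        congr 1
        refine setIntegral_congr_set ?_
        have hsplit : (Prod.fst ⁻¹' Ioc s T : Set (ℝ≥0 × ℝ))
            = Prod.fst ⁻¹' Ioo s T ∪ Prod.fst ⁻¹' {T} := by
          rw [← preimage_union, Ioo_union_right hs.2]
        rw [hsplit]
        have hn : (Prod.fst ⁻¹' Ioo s T : Set (ℝ≥0 × ℝ)) =ᵐ[κ] (∅ : Set (ℝ≥0 × ℝ)) :=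
          ae_eq_empty.2 (measure_mono_null (preimage_mono (Ioo_subset_Ioo_left hs.1.le)) hnull)
        simpa using (hn.union (ae_eq_refl (Prod.fst ⁻¹' {T}))).symm
      refine Tendsto.congr' hev ?_
      have hl2 : Tendsto (fun s => ∫ r in Ioc s T, D r * g r ∂timeMeasure) (𝓝[<] T) (𝓝 0) := by
        refine squeeze_zero_norm' (a := fun s : ℝ≥0 => K * C * ((T : ℝ) - s)) ?_ ?_
        · filter_upwards [self_mem_nhdsWithin] with s hs
          refine abs_setIntegral_time_le (le_of_lt hs) fun r hr => ?_
          rw [abs_mul, abs_of_nonneg (h0 r)]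
          exact mul_le_mul (hK r hr.2) (hC r) (h0 r) hK0
        · have : Continuous fun s : ℝ≥0 => K * C * ((T : ℝ) - s) := by fun_prop
          have := this.tendsto T
          simp only [sub_self, mul_zero] at this
          exact this.mono_left nhdsWithin_le_nhds
      simpa using hl2.sub_const (∫ z in Prod.fst ⁻¹' {T}, j z ∂κ)
    have hmT : MeasurableSet (Prod.fst ⁻¹' {T} : Set (ℝ≥0 × ℝ)) :=
      measurable_fst (measurableSet_singleton T)
    -- The claims at `T` have total mass at most `1`, so the bound for a single jump bounds the
    -- whole integral.
    have hle : ∫ z in Prod.fst ⁻¹' {T}, j z ∂κ ≤ Function.leftLim D T := by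
      have hfin : κ (Prod.fst ⁻¹' {T}) ≠ ∞ := ((hκ.simple T).trans_lt ENNReal.one_lt_top).ne
      calc _ ≤ ∫ _ in Prod.fst ⁻¹' {T}, Function.leftLim D T ∂κ := by
            refine setIntegral_mono_on_ae ((hj T).mono_set (preimage_mono (by simp)))
              (integrableOn_const hfin) hmT ?_
            filter_upwards [hjle] with z hz hzT
            have hzT : z.1 = T := hzT
            rw [hzT] at hz
            exact hz hleft
        _ = κ.real (Prod.fst ⁻¹' {T}) * Function.leftLim D T := by
            rw [setIntegral_const, smul_eq_mul]
        _ ≤ 1 * Function.leftLim D T := by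
            refine mul_le_mul_of_nonneg_right ?_ hleft
            rw [measureReal_def]
            exact ENNReal.toReal_le_of_le_ofReal zero_le_one (by simpa using hκ.simple T)
        _ = _ := one_mul _
    linarith
  obtain ⟨s₁, hs₁, hnull⟩ := hκ.exists_null_right T
  -- This length gives `C * δ ≤ 1 / 2`. On `[T, s]` there is only drift, so a lower bound `-b` on
  -- `D` improves to `-b / 2`; iterating from `-K` gives `0 ≤ D` there.
  set δ : ℝ≥0 := (2 * C.toNNReal + 1)⁻¹ with hδ
  have hδpos : 0 < δ := by positivity
  have hδC : C * δ ≤ 1 / 2 := by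
    rw [hδ]
    push_cast
    rw [Real.coe_toNNReal _ hC0, ← div_eq_mul_inv, div_le_div_iff₀ (by positivity) two_pos]
    linarith
  set s := min s₁ (T + δ) with hs
  have hTs : T < s := lt_min hs₁ (lt_add_of_pos_right _ hδpos)
  obtain ⟨K, hK0, hK⟩ := hD.exists_bound s
  have hbd : ∀ n : ℕ, ∀ r ∈ Icc T s, -(K * (1 / 2) ^ n) ≤ D r := by
    intro n
    induction n with
    | zero =>
      intro r hr
      have := (abs_le.1 (hK r hr.2)).1
      simpa using this
    | succ n ih =>
      intro r hr
      have h1 := hincr hr.1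
      have hn : κ (Prod.fst ⁻¹' Ioc T r) = 0 := measure_mono_null (preimage_mono
        (Ioc_subset_Ioc_right (hr.2.trans (min_le_left _ _)))) hnull
      rw [setIntegral_measure_zero _ hn, sub_zero] at h1
      have hKn : 0 ≤ K * (1 / 2) ^ n := by positivity
      have h2 := le_setIntegral_time (C := K * C) (c := -(K * (1 / 2) ^ n * C))
        (g := fun r => D r * g r) (hD.measurable.mul hg) hr.1 ?_ ?_
      · have h3 : (r : ℝ) - T ≤ δ := by
          have : r ≤ T + δ := hr.2.trans (min_le_right _ _)
          have : (r : ℝ) ≤ T + δ := by exact_mod_cast this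
          linarith
        have h4 : K * (1 / 2) ^ n * C * ((r : ℝ) - T) ≤ K * (1 / 2) ^ n * (1 / 2) := by
          rw [mul_assoc]
          refine mul_le_mul_of_nonneg_left ?_ hKn
          exact (mul_le_mul_of_nonneg_left h3 hC0).trans hδC
        rw [pow_succ]
        linarith
      · intro q hq
        rw [abs_mul, abs_of_nonneg (h0 q)]
        exact mul_le_mul (hK q (hq.trans hr.2)) (hC q) (h0 q) hK0
      · intro q hq
        have h5 := ih q ⟨hq.1.le, hq.2.trans hr.2⟩
        have h6 : K * (1 / 2) ^ n * g q ≤ K * (1 / 2) ^ n * C :=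
          mul_le_mul_of_nonneg_left (hC q) hKn
        have h7 : -(K * (1 / 2) ^ n) * g q ≤ D q * g q := mul_le_mul_of_nonneg_right h5 (h0 q)
        linarith
  have hpos : ∀ r ∈ Icc T s, 0 ≤ D r := by
    intro r hr
    have hl : Tendsto (fun n : ℕ => -(K * (1 / 2 : ℝ) ^ n)) atTop (𝓝 (-(K * 0))) :=
      ((tendsto_pow_atTop_nhds_zero_of_lt_one (by norm_num) (by norm_num)).const_mul K).neg
    simp only [mul_zero, neg_zero] at hl
    exact le_of_tendsto hl (.of_forall fun n => hbd n r hr)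
  obtain ⟨q, hqS, hqs⟩ := exists_lt_of_csInf_lt hne hTs
  exact absurd (hpos q ⟨csInf_le (OrderBot.bddBelow S) hqS, hqs.le⟩) (not_le.2 hqS)

end Comparison

/-! ### Construction of solutions -/

section Construction

variable {κ : Measure (ℝ≥0 × ℝ)} {g : ℝ≥0 → ℝ} {C : ℝ}

theorem primitive_zero (g : ℝ≥0 → ℝ) : primitive g 0 = 0 := setIntegral_time_zero g

/-- Variation of constants for a linear equation driven by a measure with marks. -/
theorem variation_of_constants (hκ : IsClaimPath κ) (hg : Measurable g) (h0 : ∀ s, 0 ≤ g s)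
    (hC : ∀ s, g s ≤ C) {h : ℝ≥0 × ℝ → ℝ} (hm : Measurable h)
    (hi : ∀ t, IntegrableOn h (Prod.fst ⁻¹' Iic t) κ) (d : ℝ) {Y : ℝ≥0 → ℝ}
    (hY : ∀ t, Y t = Real.exp (primitive g t)
      * (d - ∫ z in Prod.fst ⁻¹' Iic t, Real.exp (-primitive g z.1) * h z ∂κ)) (t : ℝ≥0) :
    Y t = d + ∫ s in Iic t, Y s * g s ∂timeMeasure - ∫ z in Prod.fst ⁻¹' Iic t, h z ∂κ := by
  set A := primitive g with hA
  have hAm : Measurable A := (continuous_primitive hg h0 hC).measurable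
  have hAmono : Monotone A := primitive_mono hg h0 hC
  have hA0 : A 0 = 0 := primitive_zero g
  have hApos : ∀ s, 0 ≤ A s := fun s => hA0 ▸ hAmono zero_le
  have hms : ∀ s : ℝ≥0, MeasurableSet (Prod.fst ⁻¹' Iic s : Set (ℝ≥0 × ℝ)) := fun s =>
    measurable_fst measurableSet_Iic
  have hgE : Measurable fun r => g r * Real.exp (A r) :=
    measurable_mul_exp_primitive hg h0 hC
  have hgEi : IntegrableOn (fun r => g r * Real.exp (A r)) (Iic t) timeMeasure :=
    integrableOn_time hgE fun r hr => abs_mul_exp_primitive_le hg h0 hC hr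
  have hem : Measurable fun z : ℝ≥0 × ℝ => Real.exp (-A z.1) * h z :=
    (Real.measurable_exp.comp (hAm.comp measurable_fst).neg).mul hm
  have hei : IntegrableOn (fun z => Real.exp (-A z.1) * h z) (Prod.fst ⁻¹' Iic t) κ := by
    refine Integrable.mono (hi t) hem.aestronglyMeasurable (.of_forall fun z => ?_)
    rw [norm_mul, Real.norm_eq_abs (Real.exp _), Real.abs_exp]
    refine mul_le_of_le_one_left (norm_nonneg _) (Real.exp_le_one_iff.2 ?_)
    linarith [hApos z.1]
  set μ := κ.restrict (Prod.fst ⁻¹' Iic t) with hμ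
  set ρ := timeMeasure.restrict (Iic t) with hρ
  have : IsFiniteMeasure μ := ⟨by rw [hμ, Measure.restrict_apply_univ]; exact hκ.finite t⟩
  have : IsFiniteMeasure ρ :=
    ⟨by rw [hρ, Measure.restrict_apply_univ]; exact timeMeasure_Iic_lt_top t⟩
  -- The drift integral of the claim term is the double integral of `F`. By Fubini one integrates in
  -- time first: over `[z.1, t]` this gives `exp (A t) - exp (A z.1)`, whose second part restores `h
  -- z`.
  set F : ℝ≥0 → ℝ≥0 × ℝ → ℝ := fun r z =>
    (g r * Real.exp (A r)) * (Prod.fst ⁻¹' Iic r).indicator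
      (fun z : ℝ≥0 × ℝ => Real.exp (-A z.1) * h z) z with hF
  have hFm : Measurable (Function.uncurry F) := by
    have hset : MeasurableSet {p : ℝ≥0 × (ℝ≥0 × ℝ) | p.2.1 ≤ p.1} :=
      measurableSet_le (measurable_fst.comp measurable_snd) measurable_fst
    have : Function.uncurry F = fun p : ℝ≥0 × (ℝ≥0 × ℝ) => (g p.1 * Real.exp (A p.1)) *
        {p : ℝ≥0 × (ℝ≥0 × ℝ) | p.2.1 ≤ p.1}.indicator
          (fun p => Real.exp (-A p.2.1) * h p.2) p := by
      funext p
      simp only [Function.uncurry, hF, indicator, mem_preimage, mem_Iic, mem_ofPred_eq]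
    rw [this]
    exact (hgE.comp measurable_fst).mul ((hem.comp measurable_snd).indicator hset)
  have hFi : Integrable (Function.uncurry F) (ρ.prod μ) := by
    refine Integrable.mono (Integrable.mul_prod (μ := ρ) (ν := μ) hgEi hei)
      hFm.aestronglyMeasurable (.of_forall fun p => ?_)
    simp only [Function.uncurry, hF, norm_mul]
    rw [← norm_mul (Real.exp _)]
    gcongr
    exact norm_indicator_le_norm_self _ _
  have hH : ∀ r ≤ t, (∫ z in Prod.fst ⁻¹' Iic r, Real.exp (-A z.1) * h z ∂κ)
      * (g r * Real.exp (A r)) = ∫ z, F r z ∂μ := by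
    intro r hr
    rw [hF, integral_const_mul, integral_indicator (hms r), hμ, Measure.restrict_restrict (hms r),
      inter_eq_left.2 (preimage_mono (Iic_subset_Iic.2 hr)), mul_comm]
  have hinner : ∀ᵐ z ∂μ, ∫ r, F r z ∂ρ = Real.exp (A t) * (Real.exp (-A z.1) * h z) - h z := by
    rw [hμ]
    filter_upwards [ae_restrict_mem (hms t)] with z hz
    have hz : z.1 ≤ t := hz
    have h1 : (fun r => F r z) = fun r => (Ici z.1).indicator
        (fun r => g r * Real.exp (A r)) r * (Real.exp (-A z.1) * h z) := by
      funext r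
      simp only [hF, indicator, mem_preimage, mem_Iic, mem_Ici]
      split_ifs <;> simp
    rw [h1, integral_mul_const, integral_indicator measurableSet_Ici, hρ,
      Measure.restrict_restrict measurableSet_Ici, Ici_inter_Iic,
      setIntegral_congr_set (Ioc_ae_eq_Icc (a := z.1) (b := t)).symm,
      ← exp_primitive_sub_exp_primitive hg h0 hC hz, Real.exp_neg, ← hA]
    field_simp
  have hexp : ∫ r, g r * Real.exp (A r) ∂ρ = Real.exp (A t) - 1 := by
    have h1 := exp_primitive_sub_exp_primitive hg h0 hC (zero_le : 0 ≤ t)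
    rw [primitive_zero, Real.exp_zero] at h1
    rw [h1, hρ, ← Icc_bot]
    exact setIntegral_congr_set (Ioc_ae_eq_Icc (a := (0 : ℝ≥0)) (b := t)).symm
  have hYg : ∫ s, Y s * g s ∂ρ = d * (Real.exp (A t) - 1) - ∫ r, ∫ z, F r z ∂μ ∂ρ := by
    rw [← hexp, ← integral_const_mul]
    refine Eq.trans ?_ (integral_sub (Integrable.const_mul hgEi d) hFi.integral_prod_left)
    refine integral_congr_ae ?_
    rw [hρ]
    filter_upwards [ae_restrict_mem measurableSet_Iic] with r hr
    rw [← hH r hr, hY r]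
    ring
  rw [hYg, integral_integral_swap hFi, integral_congr_ae hinner,
    integral_sub (hei.const_mul _) (hi t), integral_const_mul, hY t]
  ring

variable {Ψ : ℝ≥0 × ℝ → ℝ → ℝ}

/-- One step of the Picard iteration, the linear part of the equation being solved exactly. -/
def picardStep (κ : Measure (ℝ≥0 × ℝ)) (g : ℝ≥0 → ℝ) (Ψ : ℝ≥0 × ℝ → ℝ → ℝ) (d : ℝ)
    (D : ℝ≥0 → ℝ) (t : ℝ≥0) : ℝ :=
  Real.exp (primitive g t) * (d - ∫ z in Prod.fst ⁻¹' Iic t,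
    Real.exp (-primitive g z.1) * Ψ z (Function.leftLim D z.1) ∂κ)

/-- The Picard iteration, started from `0`. -/
def picard (κ : Measure (ℝ≥0 × ℝ)) (g : ℝ≥0 → ℝ) (Ψ : ℝ≥0 × ℝ → ℝ → ℝ) (d : ℝ) :
    ℕ → ℝ≥0 → ℝ
  | 0 => fun _ => 0
  | n + 1 => picardStep κ g Ψ d (picard κ g Ψ d n)

/-- The solution: before the `n`-th claim it is the `n`-th Picard iterate. -/
def solution (κ : Measure (ℝ≥0 × ℝ)) (g : ℝ≥0 → ℝ) (Ψ : ℝ≥0 × ℝ → ℝ → ℝ) (d : ℝ) (t : ℝ≥0) : ℝ :=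
  picard κ g Ψ d (claimCount κ t + 1) t

theorem measurable_jump (hΨm : Measurable (Function.uncurry Ψ)) {D : ℝ≥0 → ℝ} (hD : IsCadlag D) :
    Measurable fun z => Ψ z (Function.leftLim D z.1) :=
  hΨm.comp (measurable_id.prodMk (hD.measurable_leftLim.comp measurable_fst))

theorem integrableOn_jump (hκ : IsClaimPath κ) (hΨm : Measurable (Function.uncurry Ψ))
    (hΨ : ∀ z v, |Ψ z v| ≤ |v|) {D : ℝ≥0 → ℝ} (hD : IsCadlag D) (t : ℝ≥0) :
    IntegrableOn (fun z => Ψ z (Function.leftLim D z.1)) (Prod.fst ⁻¹' Iic t) κ := by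
  obtain ⟨K, hK0, hK⟩ := hD.exists_bound t
  exact integrableOn_of_bound (measurable_jump hΨm hD) (measurable_fst measurableSet_Iic)
    (hκ.finite t) fun z hz => (hΨ _ _).trans (hD.abs_leftLim_le hK hz)

theorem isCadlag_picardStep (hκ : IsClaimPath κ) (hg : Measurable g) (h0 : ∀ s, 0 ≤ g s)
    (hC : ∀ s, g s ≤ C) (hΨm : Measurable (Function.uncurry Ψ)) (hΨ : ∀ z v, |Ψ z v| ≤ |v|)
    (d : ℝ) {D : ℝ≥0 → ℝ} (hD : IsCadlag D) : IsCadlag (picardStep κ g Ψ d D) := by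
  have hA := continuous_primitive hg h0 hC
  refine (isCadlag_of_continuous (Real.continuous_exp.comp hA)).mul
    ((isCadlag_of_continuous continuous_const).sub (hκ.isCadlag_setIntegral fun t => ?_))
  refine Integrable.mono (integrableOn_jump hκ hΨm hΨ hD t) ((Real.measurable_exp.comp
    (hA.measurable.comp measurable_fst).neg).mul
    (measurable_jump hΨm hD)).aestronglyMeasurable (.of_forall fun z => ?_)
  rw [norm_mul, Real.norm_eq_abs (Real.exp _), Real.abs_exp]
  refine mul_le_of_le_one_left (norm_nonneg _) (Real.exp_le_one_iff.2 ?_)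
  have h1 := primitive_mono hg h0 hC (zero_le : 0 ≤ z.1)
  rw [primitive_zero] at h1
  linarith

theorem isCadlag_picard (hκ : IsClaimPath κ) (hg : Measurable g) (h0 : ∀ s, 0 ≤ g s)
    (hC : ∀ s, g s ≤ C) (hΨm : Measurable (Function.uncurry Ψ)) (hΨ : ∀ z v, |Ψ z v| ≤ |v|)
    (d : ℝ) (n : ℕ) : IsCadlag (picard κ g Ψ d n) := by
  induction n with
  | zero => exact isCadlag_of_continuous continuous_const
  | succ n ih => exact isCadlag_picardStep hκ hg h0 hC hΨm hΨ d ih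

variable (hκ : IsClaimPath κ) (hg : Measurable g) (h0 : ∀ s, 0 ≤ g s)
  (hC : ∀ s, g s ≤ C) (hΨm : Measurable (Function.uncurry Ψ)) (hΨ : ∀ z v, |Ψ z v| ≤ |v|) (d : ℝ)
include hκ hg h0 hC hΨm hΨ

/-- A step uses the previous iterate only strictly before claim times `z.1 ≤ t`, where the claim
count is smaller than at `t`; there the two previous iterates agree by induction. -/
theorem picard_succ_eq (n : ℕ) :
    ∀ t, claimCount κ t < n → picard κ g Ψ d (n + 1) t = picard κ g Ψ d n t := by
  induction n with
  | zero => intro t ht; omega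
  | succ n ih =>
    intro t ht
    simp only [picard, picardStep]
    congr 2
    refine integral_congr_ae ((ae_restrict_iff' (measurable_fst measurableSet_Iic)).2 ?_)
    filter_upwards [hκ.ae_claimCount_lt t, hκ.ae_pos] with z hz hpos hzt
    have := leftLim_congr (isCadlag_picard hκ hg h0 hC hΨm hΨ d n) hpos fun s hs =>
      (ih s (by have := hz hzt s hs; omega)).symm
    simp only [picard] at this
    rw [this]

theorem picard_eq_solution {n : ℕ} {t : ℝ≥0} (hn : claimCount κ t < n) :
    picard κ g Ψ d n t = solution κ g Ψ d t := by
  induction n, hn using Nat.le_induction with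
  | base => rfl
  | succ n hn ih => rw [picard_succ_eq hκ hg h0 hC hΨm hΨ d n t hn, ih]

/-- On `[0, t + 1]` the solution coincides with a single iterate. -/
theorem isCadlag_solution : IsCadlag (solution κ g Ψ d) := by
  intro t
  have hc := isCadlag_picard hκ hg h0 hC hΨm hΨ d (claimCount κ (t + 1) + 1) t
  have hev : ∀ s ≤ t + 1, solution κ g Ψ d s = picard κ g Ψ d (claimCount κ (t + 1) + 1) s :=
    fun s hs => (picard_eq_solution hκ hg h0 hC hΨm hΨ d
      (Nat.lt_succ_of_le (hκ.claimCount_mono hs))).symm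
  have hlt : t < t + 1 := lt_add_of_pos_right _ one_pos
  constructor
  · refine hc.1.congr_of_eventuallyEq ?_ (hev t hlt.le)
    filter_upwards [Icc_mem_nhdsGE hlt] with s hs using hev s hs.2
  · obtain ⟨l, hl⟩ := hc.2
    refine ⟨l, hl.congr' ?_⟩
    filter_upwards [self_mem_nhdsWithin] with s hs
    exact (hev s ((le_of_lt hs).trans hlt.le)).symm

/-- Up to time `t` two consecutive iterates both equal the solution, so variation of constants for
one step is already the fixed-point equation. -/
theorem solution_equation (t : ℝ≥0) :
    solution κ g Ψ d t = d + ∫ s in Iic t, solution κ g Ψ d s * g s ∂timeMeasure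
      - ∫ z in Prod.fst ⁻¹' Iic t, Ψ z (Function.leftLim (solution κ g Ψ d) z.1) ∂κ := by
  set n := claimCount κ t + 1 with hn
  have hev : ∀ s ≤ t, ∀ k ≥ n, picard κ g Ψ d k s = solution κ g Ψ d s := fun s hs k hk =>
    picard_eq_solution hκ hg h0 hC hΨm hΨ d
      (lt_of_le_of_lt (hκ.claimCount_mono hs) (by omega))
  have hcad := isCadlag_picard hκ hg h0 hC hΨm hΨ d n
  have h := variation_of_constants hκ hg h0 hC (measurable_jump hΨm hcad)
    (integrableOn_jump hκ hΨm hΨ hcad) d (Y := picard κ g Ψ d (n + 1)) (fun t => rfl) t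
  rw [hev t le_rfl (n + 1) (by omega)] at h
  rw [h]
  congr 1
  · congr 1
    refine setIntegral_congr_fun measurableSet_Iic fun s hs => ?_
    rw [hev s hs (n + 1) (by omega)]
  · refine integral_congr_ae ((ae_restrict_iff' (measurable_fst measurableSet_Iic)).2 ?_)
    filter_upwards [hκ.ae_pos] with z hpos hzt
    have hzt : z.1 ≤ t := hzt
    rw [← leftLim_congr hcad hpos fun s hs => hev s (hs.le.trans hzt) n le_rfl]

theorem tendsto_picard (t : ℝ≥0) :
    Tendsto (fun n => picard κ g Ψ d n t) atTop (𝓝 (solution κ g Ψ d t)) := by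
  refine tendsto_const_nhds.congr' ?_
  filter_upwards [eventually_gt_atTop (claimCount κ t)] with n hn
  exact (picard_eq_solution hκ hg h0 hC hΨm hΨ d hn).symm

end Construction

/-! ### Measurability of the solutions -/

/-- The integral of a jointly measurable function against a measurable family of finite measures
is measurable. -/
theorem measurable_integral_of_finite {Ω E : Type*} {m : MeasurableSpace Ω} [MeasurableSpace E]
    {κ : Ω → Measure E} (hκ : Measurable κ) (hfin : ∀ ω, κ ω univ < ∞) {h : Ω × E → ℝ}
    (hh : Measurable h) : Measurable fun ω => ∫ z, h (ω, z) ∂κ ω := by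
  classical
  have hmass : ∀ n : ℕ, MeasurableSet {ω | κ ω univ ≤ n} := fun n =>
    measurableSet_le ((Measure.measurable_coe MeasurableSet.univ).comp hκ) measurable_const
  -- Cutting off where the mass exceeds `n` gives finite kernels, and for each `ω` the cut is
  -- eventually inactive.
  set κ' : ℕ → Kernel Ω E := fun n =>
    { toFun := fun ω => if κ ω univ ≤ n then κ ω else 0
      measurable' := Measurable.ite (hmass n) hκ measurable_const } with hκ'
  have hκ'_apply : ∀ n ω, κ' n ω = if κ ω univ ≤ n then κ ω else 0 := fun n ω => rfl
  have hfinK : ∀ n, IsFiniteKernel (κ' n) := fun n =>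
    ⟨n, ENNReal.natCast_lt_top n, fun ω => by
      rw [hκ'_apply]
      split_ifs with hω
      · exact hω
      · simp⟩
  refine measurable_of_tendsto_metrizable (f := fun n ω => ∫ z, h (ω, z) ∂κ' n ω)
    (fun n => ?_) (tendsto_pi_nhds.2 fun ω => ?_)
  · exact (StronglyMeasurable.integral_kernel_prod_right' (κ := κ' n)
      hh.stronglyMeasurable).measurable
  · refine tendsto_const_nhds.congr' ?_
    obtain ⟨n₀, hn₀⟩ := ENNReal.exists_nat_gt (hfin ω).ne
    filter_upwards [eventually_ge_atTop n₀] with n hn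
    rw [hκ'_apply, if_pos (hn₀.le.trans (by exact_mod_cast hn))]

section Measurability

variable {Ω : Type*} {κ : Ω → Measure (ℝ≥0 × ℝ)} {g : ℝ≥0 → Ω → ℝ} {C : ℝ}
  {Ψ : Ω → ℝ≥0 × ℝ → ℝ → ℝ}

theorem measurable_primitive {m : MeasurableSpace Ω} {t : ℝ≥0}
    (hgm : Measurable fun p : ℝ≥0 × Ω => g (min p.1 t) p.2) {r : ℝ≥0} (hr : r ≤ t) :
    Measurable fun ω => primitive (fun s => g s ω) r := by
  have h := (StronglyMeasurable.integral_prod_left' (μ := timeMeasure.restrict (Iic r))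
    hgm.stronglyMeasurable).measurable
  convert h using 2 with ω
  refine setIntegral_congr_fun measurableSet_Iic fun s hs => ?_
  simp only
  rw [min_eq_left (le_trans hs hr)]

/-- Replacing every time `s` by `min s t` changes nothing in an integral over `[0,t]`, but makes the
integrand jointly measurable with respect to information up to time `t`. -/
theorem measurable_picardStep {m : MeasurableSpace Ω} {t : ℝ≥0}
    (hκfin : ∀ ω, κ ω (Prod.fst ⁻¹' Iic t) < ∞)
    (hκm : Measurable fun ω => (κ ω).restrict (Prod.fst ⁻¹' Iic t))
    (hg : ∀ ω, Measurable fun s => g s ω) (h0 : ∀ ω s, 0 ≤ g s ω) (hC : ∀ ω s, g s ω ≤ C)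
    (hgm : Measurable fun p : ℝ≥0 × Ω => g (min p.1 t) p.2)
    (hΨm : Measurable fun q : Ω × ((ℝ≥0 × ℝ) × ℝ) => Ψ q.1 (min q.2.1.1 t, q.2.1.2) q.2.2)
    (d : ℝ) {D : ℝ≥0 → Ω → ℝ} (hD : ∀ ω, IsCadlag fun s => D s ω)
    (hDm : ∀ r ≤ t, Measurable (D r)) :
    Measurable fun ω => picardStep (κ ω) (fun s => g s ω) (Ψ ω) d (fun s => D s ω) t := by
  have hAc : ∀ ω, Continuous (primitive fun s => g s ω) := fun ω =>
    continuous_primitive (hg ω) (h0 ω) (hC ω)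
  have hmin : Measurable fun s : ℝ≥0 => min s t := measurable_id.min measurable_const
  -- The primitive is continuous, hence equal to its left limit, so the result on left limits gives
  -- joint measurability.
  have hA : Measurable fun p : ℝ≥0 × Ω => primitive (fun s => g s p.2) (min p.1 t) := by
    have h := measurable_leftLim_comp (D := fun r ω => primitive (fun s => g s ω) r)
      (fun ω => isCadlag_of_continuous (hAc ω)) hmin (fun s => min_le_right s t)
      fun r hr => measurable_primitive hgm hr
    convert h using 2 with p
    exact ((hAc p.2).continuousWithinAt.leftLim_eq).symm
  have hl : Measurable fun p : ℝ≥0 × Ω => Function.leftLim (fun s => D s p.2) (min p.1 t) :=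
    measurable_leftLim_comp hD hmin (fun s => min_le_right s t) hDm
  have hswap : Measurable fun q : Ω × (ℝ≥0 × ℝ) => (q.2.1, q.1) :=
    (measurable_fst.comp measurable_snd).prodMk measurable_fst
  have hH : Measurable fun q : Ω × (ℝ≥0 × ℝ) =>
      Real.exp (-primitive (fun s => g s q.1) (min q.2.1 t))
        * Ψ q.1 (min q.2.1 t, q.2.2) (Function.leftLim (fun s => D s q.1) (min q.2.1 t)) := by
    refine (Real.measurable_exp.comp (hA.comp hswap).neg).mul ?_
    exact hΨm.comp (measurable_fst.prodMk (measurable_snd.prodMk (hl.comp hswap)))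
  have hI := measurable_integral_of_finite hκm (fun ω => by
    rw [Measure.restrict_apply_univ]; exact hκfin ω) hH
  refine (Real.measurable_exp.comp (measurable_primitive hgm le_rfl)).mul
    (measurable_const.sub ?_)
  convert hI using 2 with ω
  refine setIntegral_congr_fun (measurable_fst measurableSet_Iic) fun z hz => ?_
  have hz : z.1 ≤ t := hz
  simp only [min_eq_left hz, Prod.mk.eta]

theorem measurable_solution {mΩ : MeasurableSpace Ω} (ℱ : Filtration ℝ≥0 mΩ)
    (hκ : ∀ ω, IsClaimPath (κ ω))
    (hκm : ∀ t, Measurable[ℱ t] fun ω => (κ ω).restrict (Prod.fst ⁻¹' Iic t))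
    (hg : ∀ ω, Measurable fun s => g s ω) (h0 : ∀ ω s, 0 ≤ g s ω) (hC : ∀ ω s, g s ω ≤ C)
    (hgm : ∀ t, Measurable[NNReal.measurableSpace.prod (ℱ t)]
      fun p : ℝ≥0 × Ω => g (min p.1 t) p.2)
    (hΨp : ∀ ω, Measurable (Function.uncurry (Ψ ω))) (hΨ : ∀ ω z v, |Ψ ω z v| ≤ |v|)
    (hΨm : ∀ t, Measurable[(ℱ t).prod inferInstance]
      fun q : Ω × ((ℝ≥0 × ℝ) × ℝ) => Ψ q.1 (min q.2.1.1 t, q.2.1.2) q.2.2) (d : ℝ) (t : ℝ≥0) :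
    Measurable[ℱ t] fun ω => solution (κ ω) (fun s => g s ω) (Ψ ω) d t := by
  have hpicard : ∀ n t, Measurable[ℱ t] fun ω =>
      picard (κ ω) (fun s => g s ω) (Ψ ω) d n t := by
    intro n
    induction n with
    | zero => exact fun t => measurable_const
    | succ n ih =>
      intro t
      exact measurable_picardStep (m := ℱ t) (fun ω => (hκ ω).finite t) (hκm t) hg h0 hC (hgm t)
        (hΨm t) d (D := fun s ω => picard (κ ω) (fun s => g s ω) (Ψ ω) d n s)
        (fun ω => isCadlag_picard (hκ ω) (hg ω) (h0 ω) (hC ω) (hΨp ω) (hΨ ω) d n)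
        fun r hr => (ih r).mono (ℱ.mono hr) le_rfl
  exact @measurable_of_tendsto_metrizable Ω ℝ (ℱ t) _ _ _ _ _ _ (fun n => hpicard n t)
    (tendsto_pi_nhds.2 fun ω =>
      tendsto_picard (hκ ω) (hg ω) (h0 ω) (hC ω) (hΨp ω) (hΨ ω) d t)

end Measurability

/-! ### Progressive processes -/

theorem IsStronglyProgressive.measurable_min {Ω : Type*} {mΩ : MeasurableSpace Ω}
    {ℱ : Filtration ℝ≥0 mΩ} {u : ℝ≥0 → Ω → ℝ} (hu : IsStronglyProgressive ℱ u) (t : ℝ≥0) :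
    Measurable[NNReal.measurableSpace.prod (ℱ t)] fun p : ℝ≥0 × Ω => u (min p.1 t) p.2 := by
  have h := (hu t).measurable
  have h2 : Measurable[NNReal.measurableSpace.prod (ℱ t), Subtype.instMeasurableSpace.prod (ℱ t)]
      fun p : ℝ≥0 × Ω => ((⟨min p.1 t, mem_Iic.2 (min_le_right _ _)⟩ : Iic t), p.2) := by
    let := ℱ t
    exact (Measurable.subtype_mk (measurable_fst.min measurable_const)).prodMk measurable_snd
  exact h.comp h2

theorem IsStronglyProgressive.measurable_path {Ω : Type*} {mΩ : MeasurableSpace Ω}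
    {ℱ : Filtration ℝ≥0 mΩ} {u : ℝ≥0 → Ω → ℝ} (hu : IsStronglyProgressive ℱ u) (ω : Ω) :
    Measurable fun s => u s ω := by
  refine measurable_of_tendsto_metrizable (f := fun (n : ℕ) s => u (min s n) ω) (fun n => ?_)
    (tendsto_pi_nhds.2 fun s => ?_)
  · let := ℱ n
    exact (IsStronglyProgressive.measurable_min hu n).comp measurable_prodMk_right
  · refine tendsto_const_nhds.congr' ?_
    obtain ⟨n₀, hn₀⟩ := exists_nat_ge s
    filter_upwards [eventually_ge_atTop n₀] with n hn
    rw [min_eq_left (hn₀.trans (by exact_mod_cast hn))]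

/-! ### The claim function and the premium rate -/

theorem IsClaimFunction.eq_zero_of_nonpos {f : ℝ≥0 → ℝ → ℝ≥0} {K₀ : ℝ≥0}
    (hf : IsClaimFunction f K₀) (n : ℝ≥0) {y : ℝ} (hy : y ≤ 0) : f n y = 0 :=
  le_antisymm ((hf.mono_right n hy).trans (hf.zero_right n).le) zero_le

/-- For negative `y` the function vanishes by monotonicity, so the Lipschitz bound needs no sign
condition. -/
theorem IsClaimFunction.abs_sub_le {f : ℝ≥0 → ℝ → ℝ≥0} {K₀ : ℝ≥0}
    (hf : IsClaimFunction f K₀) (n n' : ℝ≥0) (y : ℝ) :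
    |(f n y : ℝ) - f n' y| ≤ K₀ * |(n : ℝ) - n'| := by
  rcases le_total y 0 with hy | hy
  · rw [hf.eq_zero_of_nonpos n hy, hf.eq_zero_of_nonpos n' hy]
    simp only [sub_self, abs_zero]
    positivity
  · have h := (hf.lipschitz y hy).dist_le_mul n n'
    simpa only [NNReal.dist_eq] using h

theorem IsClaimFunction.le_mul {f : ℝ≥0 → ℝ → ℝ≥0} {K₀ : ℝ≥0}
    (hf : IsClaimFunction f K₀) (n : ℝ≥0) (y : ℝ) : (f n y : ℝ) ≤ K₀ * n := by
  rcases le_total y 0 with hy | hy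
  · rw [hf.eq_zero_of_nonpos n hy, NNReal.coe_zero]
    positivity
  · have h := hf.abs_sub_le n 0 y
    rw [hf.zero_left y hy] at h
    simpa using h

namespace Model

variable {M : Model} {K₀ : ℝ≥0}

theorem ν_nonneg : 0 ≤ M.ν := integral_nonneg fun _ => NNReal.coe_nonneg _

theorem IsValid.a_nonneg (hM : M.IsValid K₀) : 0 ≤ M.a :=
  div_nonneg zero_le_one (mul_nonneg hM.ζ₀_pos.le ν_nonneg)

theorem IsValid.integrable_claim (hM : M.IsValid K₀) (u : ℝ) :
    Integrable (fun y => (M.f 1 (max (y - u) 0) : ℝ)) M.G := by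
  have := hM.isProbabilityMeasure_G
  have hc : Continuous fun y : ℝ => (M.f 1 (max (y - u) 0) : ℝ) :=
    NNReal.continuous_coe.comp (hM.claim.continuous.comp
      (continuous_const.prodMk ((continuous_id.sub continuous_const).max continuous_const)))
  refine Integrable.of_bound hc.measurable.aestronglyMeasurable (K₀ : ℝ) (.of_forall fun y => ?_)
  rw [Real.norm_eq_abs, abs_of_nonneg (NNReal.coe_nonneg _)]
  simpa using hM.claim.le_mul 1 (max (y - u) 0)

/-- A higher retention level means less ceded risk; monotonicity provides the measurability of
`p(u)` along paths. -/
theorem IsValid.monotone_p (hM : M.IsValid K₀) : Monotone M.p := by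
  intro u v huv
  have hint : ∫ y, (M.f 1 (max (y - v) 0) : ℝ) ∂M.G ≤ ∫ y, (M.f 1 (max (y - u) 0) : ℝ) ∂M.G := by
    refine integral_mono (hM.integrable_claim v) (hM.integrable_claim u) fun y => ?_
    exact NNReal.coe_le_coe.2 (hM.claim.mono_right 1 (max_le_max (by linarith) le_rfl))
  have hk : 0 ≤ (1 + M.k₂) * M.β :=
    mul_nonneg (by linarith [hM.k₁_nonneg, hM.k₁_lt_k₂]) hM.β_pos.le
  have := mul_le_mul_of_nonneg_left hint hk
  simp only [p]
  linarith

theorem IsValid.p_le (hM : M.IsValid K₀) (u : ℝ) : M.p u ≤ (1 + M.k₁) * M.β * M.ν := by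
  have hk : 0 ≤ (1 + M.k₂) * M.β :=
    mul_nonneg (by linarith [hM.k₁_nonneg, hM.k₁_lt_k₂]) hM.β_pos.le
  have hint : 0 ≤ ∫ y, (M.f 1 (max (y - u) 0) : ℝ) ∂M.G :=
    integral_nonneg fun _ => NNReal.coe_nonneg _
  have := mul_nonneg hk hint
  simp only [p]
  linarith

theorem IsValid.p_nonneg (hM : M.IsValid K₀) {u : ℝ} (hu : M.uMin ≤ u) : 0 ≤ M.p u :=
  (mul_nonneg hM.β_pos.le (integral_nonneg fun _ => NNReal.coe_nonneg _)).trans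
    (hM.premium_covers u hu)

/-- An upper bound for the growth rate `a p(u)`. -/
def rateBound (M : Model) : ℝ := M.a * ((1 + M.k₁) * M.β * M.ν)

theorem IsValid.rate_le (hM : M.IsValid K₀) (u : ℝ) : M.a * M.p u ≤ M.rateBound :=
  mul_le_mul_of_nonneg_left (hM.p_le u) hM.a_nonneg

theorem IsValid.rateBound_nonneg (hM : M.IsValid K₀) : 0 ≤ M.rateBound :=
  (mul_nonneg hM.a_nonneg (hM.p_nonneg le_rfl)).trans (hM.rate_le M.uMin)

/-- The amount paid for a claim `y` by the company with fortune `v`. -/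
def payment (M : Model) (v y : ℝ) : ℝ := (M.f (M.a * v).toNNReal y : ℝ)

theorem IsValid.continuous_payment (hM : M.IsValid K₀) :
    Continuous fun q : ℝ × ℝ => M.payment q.1 q.2 :=
  NNReal.continuous_coe.comp (hM.claim.continuous.comp
    ((continuous_real_toNNReal.comp (continuous_const.mul continuous_fst)).prodMk continuous_snd))

/-- Here `a K₀ ≤ 1` enters: a claim can at most cancel the difference of two fortunes, never reverse
its sign. -/
theorem IsValid.abs_payment_sub_le (hM : M.IsValid K₀) (v w y : ℝ) :
    |M.payment v y - M.payment w y| ≤ |v - w| := by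
  have h1 := hM.claim.abs_sub_le (M.a * v).toNNReal (M.a * w).toNNReal y
  have h2 : |((M.a * v).toNNReal : ℝ) - (M.a * w).toNNReal| ≤ M.a * |v - w| := by
    have := abs_max_sub_max_le_abs (M.a * v) (M.a * w) 0
    rwa [← mul_sub, abs_mul, abs_of_nonneg hM.a_nonneg] at this
  calc _ ≤ K₀ * |((M.a * v).toNNReal : ℝ) - (M.a * w).toNNReal| := h1
    _ ≤ K₀ * (M.a * |v - w|) := by gcongr
    _ = (M.a * K₀) * |v - w| := by ring
    _ ≤ 1 * |v - w| := by gcongr; exact hM.a_mul_K₀_le_one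
    _ = _ := one_mul _

theorem IsValid.abs_payment_le (hM : M.IsValid K₀) (v y : ℝ) : |M.payment v y| ≤ |v| := by
  have h := hM.abs_payment_sub_le v 0 y
  have h0 : M.payment 0 y = 0 := by
    rw [payment, mul_zero, Real.toNNReal_zero]
    rcases le_total y 0 with hy | hy
    · rw [hM.claim.eq_zero_of_nonpos 0 hy, NNReal.coe_zero]
    · rw [hM.claim.zero_left y hy, NNReal.coe_zero]
  rwa [h0, sub_zero, sub_zero] at h

/-- The total payment for a path `X` of the fortune and a path `u` of the retention level has an
integrable density with respect to the claims. -/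
theorem IsValid.integrableOn_payment (hM : M.IsValid K₀) {κ : Measure (ℝ≥0 × ℝ)}
    (hκ : IsClaimPath κ) {X u : ℝ≥0 → ℝ} (hX : IsCadlag X) (hu : Measurable u) (t : ℝ≥0) :
    IntegrableOn (fun z => M.payment (Function.leftLim X z.1) (min z.2 (u z.1)))
      (Prod.fst ⁻¹' Iic t) κ := by
  obtain ⟨K, hK0, hK⟩ := hX.exists_bound t
  refine integrableOn_of_bound (C := K) ?_ (measurable_fst measurableSet_Iic) (hκ.finite t)
    fun z hz => (hM.abs_payment_le _ _).trans (hX.abs_leftLim_le hK hz)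
  exact hM.continuous_payment.measurable.comp ((hX.measurable_leftLim.comp measurable_fst).prodMk
    (measurable_snd.min (hu.comp measurable_fst)))

/-- Absorbing the restriction to `B` into the measure leaves domains that depend on time alone. -/
theorem setIntegral_restrict_marks (M : Model) (m : Measure (ℝ≥0 × ℝ))
    (h : ℝ≥0 × ℝ → ℝ) (t : ℝ≥0) :
    ∫ z in Prod.fst ⁻¹' Iic t, h z ∂(m.restrict (univ ×ˢ M.B)) = ∫ z in Iic t ×ˢ M.B, h z ∂m := by
  rw [Measure.restrict_restrict (measurable_fst measurableSet_Iic), ← prod_univ, prod_inter_prod,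
    inter_univ, univ_inter]

end Model

/-! ### Regularity of the claims -/

section Poisson

variable {Ω : Type*} [MeasurableSpace Ω] {P : Measure Ω} {M : Model} {K₀ : ℝ≥0}
  {Λ : Measure (ℝ≥0 × ℝ)} {N : Ω → Measure (ℝ≥0 × ℝ)}

theorem IsPoissonRandomMeasure.ae_lt_top (hN : IsPoissonRandomMeasure P Λ N)
    {A : Set (ℝ≥0 × ℝ)} (hA : MeasurableSet A) (hΛ : Λ A ≠ ∞) : ∀ᵐ ω ∂P, N ω A < ∞ := by
  have hm : Measurable fun ω => N ω A := (Measure.measurable_coe hA).comp hN.measurable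
  have h : ∀ᵐ y ∂(P.map fun ω => N ω A), y < ∞ := by
    rw [hN.poissonLaw A hA hΛ, ae_map_iff measurable_from_top.aemeasurable
      measurableSet_Iio]
    exact .of_forall fun n => ENNReal.natCast_lt_top n
  exact ae_of_ae_map hm.aemeasurable h

theorem IsPoissonRandomMeasure.ae_eq_zero (hN : IsPoissonRandomMeasure P Λ N)
    {A : Set (ℝ≥0 × ℝ)} (hA : MeasurableSet A) (hΛ : Λ A = 0) : ∀ᵐ ω ∂P, N ω A = 0 := by
  have hm : Measurable fun ω => N ω A := (Measure.measurable_coe hA).comp hN.measurable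
  have h : ∀ᵐ y ∂(P.map fun ω => N ω A), y = 0 := by
    rw [hN.poissonLaw A hA (by simp [hΛ]), ae_map_iff (p := fun y => y = 0)
      measurable_from_top.aemeasurable (measurableSet_singleton 0), hΛ, ENNReal.toNNReal_zero]
    have h0 : poissonMeasure 0 {0} = 1 := by simp [poissonMeasure_singleton]
    rw [ae_iff]
    refine measure_mono_null (fun n hn => ?_)
      ((prob_compl_eq_zero_iff (MeasurableSet.singleton 0)).2 h0)
    simpa using hn
  exact ae_of_ae_map hm.aemeasurable h

/-- The intensity of `[0,n]` is `n β < ∞` and that of `{0}` is `0`; integer horizons suffice, so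
only countably many null sets are discarded. -/
theorem Model.IsValid.ae_isClaimPath (hM : M.IsValid K₀)
    (hN : IsPoissonRandomMeasure P M.intensity N) :
    ∀ᵐ ω ∂P, IsClaimPath ((N ω).restrict (univ ×ˢ M.B)) := by
  have hG := hM.isProbabilityMeasure_G
  have hΛ : ∀ S, MeasurableSet S → M.intensity (S ×ˢ univ) = timeMeasure S * ENNReal.ofReal M.β := by
    intro S hS
    rw [Model.intensity, Measure.prod_prod]
    simp
  have hfin : ∀ᵐ ω ∂P, ∀ n : ℕ, N ω (Iic (n : ℝ≥0) ×ˢ univ) < ∞ := by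
    refine ae_all_iff.2 fun n => hN.ae_lt_top (measurableSet_Iic.prod .univ) ?_
    rw [hΛ _ measurableSet_Iic, timeMeasure_Iic]
    exact ENNReal.mul_ne_top ENNReal.coe_ne_top ENNReal.ofReal_ne_top
  have hzero : ∀ᵐ ω ∂P, N ω (({0} : Set ℝ≥0) ×ˢ univ) = 0 := by
    refine hN.ae_eq_zero ((measurableSet_singleton 0).prod .univ) ?_
    rw [hΛ _ (measurableSet_singleton 0), measure_singleton, zero_mul]
  filter_upwards [hN.integerValued, hN.timeSimple, hfin, hzero] with ω h1 h2 h3 h4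
  refine ⟨fun t => ?_, fun A hA => ?_, fun t => ?_, ?_⟩
  · obtain ⟨n, hn⟩ := exists_nat_ge t
    refine ((Measure.restrict_apply_le _ _).trans (measure_mono ?_)).trans_lt (h3 n)
    rw [prod_univ]
    exact preimage_mono (Iic_subset_Iic.2 hn)
  · rw [Measure.restrict_apply hA]
    exact h1 _ (hA.inter (MeasurableSet.univ.prod hM.measurableSet_B))
  · rw [← prod_univ]
    exact (Measure.restrict_apply_le _ _).trans (h2 t)
  · rw [← prod_univ]
    exact le_antisymm ((Measure.restrict_apply_le _ _).trans h4.le) zero_le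

end Poisson

theorem measurable_ite_mem {Ω E : Type*} {m : MeasurableSpace Ω} [MeasurableSpace E] {S : Set Ω}
    [DecidablePred (· ∈ S)] (hS : MeasurableSet S) {h : Ω → E} (hh : Measurable h) (c : E) :
    Measurable fun ω => if ω ∈ S then h ω else c :=
  Measurable.ite hS hh measurable_const

/-! ### The reserve processes -/

/-- If `X` solves the reserve equation, then so does `X + D` (with the initial reserve increased by
`d`) if and only if `D` solves the difference equation. -/
theorem Model.IsValid.reserve_add_iff {M : Model} {K₀ : ℝ≥0} (hM : M.IsValid K₀)
    {m : Measure (ℝ≥0 × ℝ)} (hκ : IsClaimPath (m.restrict (univ ×ˢ M.B))) {x d : ℝ}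
    {u l X D : ℝ≥0 → ℝ} (hu : Measurable u) (hmin : ∀ t, M.uMin ≤ u t) (hX : IsCadlag X)
    (hD : IsCadlag D) {t : ℝ≥0}
    (heq : X t = x + M.a * ∫ s in Iic t, X s * M.p (u s) ∂timeMeasure
      - ∫ z in Iic t ×ˢ M.B, M.payment (Function.leftLim X z.1) (min z.2 (u z.1)) ∂m - l t) :
    (X t + D t = x + d + M.a * ∫ s in Iic t, (X s + D s) * M.p (u s) ∂timeMeasure
      - ∫ z in Iic t ×ˢ M.B, M.payment (Function.leftLim (fun s => X s + D s) z.1)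
          (min z.2 (u z.1)) ∂m - l t) ↔
    D t = d + ∫ s in Iic t, D s * (M.a * M.p (u s)) ∂timeMeasure
      - ∫ z in Prod.fst ⁻¹' Iic t,
        (M.payment (Function.leftLim X z.1 + Function.leftLim D z.1) (min z.2 (u z.1))
          - M.payment (Function.leftLim X z.1) (min z.2 (u z.1))) ∂(m.restrict (univ ×ˢ M.B)) := by
  have hpm : Measurable fun s => M.p (u s) := hM.monotone_p.measurable.comp hu
  have hint : ∀ {Y : ℝ≥0 → ℝ}, IsCadlag Y →
      IntegrableOn (fun s => Y s * M.p (u s)) (Iic t) timeMeasure := by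
    intro Y hY
    obtain ⟨K, hK0, hK⟩ := hY.exists_bound t
    refine integrableOn_time (g := fun s => Y s * M.p (u s))
      (C := K * ((1 + M.k₁) * M.β * M.ν)) (hY.measurable.mul hpm)
      fun s hs => ?_
    rw [abs_mul, abs_of_nonneg (hM.p_nonneg (hmin s))]
    exact mul_le_mul (hK s hs) (hM.p_le _) (hM.p_nonneg (hmin s)) hK0
  have h1 : M.a * ∫ s in Iic t, (X s + D s) * M.p (u s) ∂timeMeasure
      = M.a * (∫ s in Iic t, X s * M.p (u s) ∂timeMeasure)
        + ∫ s in Iic t, D s * (M.a * M.p (u s)) ∂timeMeasure := by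
    simp only [add_mul]
    rw [integral_add (hint hX) (hint hD), mul_add, ← integral_const_mul M.a (fun s => D s * _)]
    congr 2
    funext s
    ring
  have hpay : (fun z : ℝ≥0 × ℝ => M.payment (Function.leftLim (fun s => X s + D s) z.1)
      (min z.2 (u z.1))) = fun z => M.payment (Function.leftLim X z.1 + Function.leftLim D z.1)
      (min z.2 (u z.1)) := by
    funext z
    rw [hX.leftLim_add hD]
  have hi := hM.integrableOn_payment hκ (hX.add hD) hu t
  rw [hpay] at hi
  rw [integral_sub hi (hM.integrableOn_payment hκ hX hu t), h1, hpay]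
  rw [← Model.setIntegral_restrict_marks] at heq ⊢
  constructor <;> intro h <;> linarith

section Reserve

variable {Ω : Type*} [mΩ : MeasurableSpace Ω] {P : Measure Ω} {M : Model} {K₀ : ℝ≥0}
  {N : Ω → Measure (ℝ≥0 × ℝ)} {ℱ : Filtration ℝ≥0 mΩ} {x x' : ℝ} {u L : ℝ≥0 → Ω → ℝ}

/-- The reserve process is nondecreasing in the initial reserve. -/
theorem Model.IsReserve.ae_le (hM : M.IsValid K₀) (hN : IsPoissonRandomMeasure P M.intensity N)
    (hxx' : x ≤ x') (hu : IsStronglyProgressive ℱ u) (hmin : ∀ᵐ ω ∂P, ∀ t, M.uMin ≤ u t ω)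
    {X X' : ℝ≥0 → Ω → ℝ} (hX : M.IsReserve P ℱ N x u L X) (hX' : M.IsReserve P ℱ N x' u L X') :
    ∀ᵐ ω ∂P, ∀ t, X t ω ≤ X' t ω := by
  filter_upwards [hM.ae_isClaimPath hN, hX.cadlag, hX'.cadlag, hX.equation, hX'.equation, hmin]
    with ω hκ hXc hXc' hXe hXe' hminω
  have huω := IsStronglyProgressive.measurable_path hu ω
  have hDc : IsCadlag fun s => X' s ω - X s ω := hXc'.sub hXc
  -- Both reserves have the same dividends, so `L` disappears from the equation of the difference.
  have hDe := fun t => (hM.reserve_add_iff (d := x' - x) (l := fun t => L t ω) hκ huω hminω hXc hDc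
    (hXe t)).1 (by
      simp only [add_sub_cancel]
      exact hXe' t)
  have hD0 := nonneg_of_equation (C := M.rateBound) hκ
    ((hM.monotone_p.measurable.comp huω).const_mul M.a)
    (fun s => mul_nonneg hM.a_nonneg (hM.p_nonneg (hminω s))) (fun s => hM.rate_le _) hDc
    (sub_nonneg.2 hxx') (fun t => ?_) (.of_forall fun z hz => ?_) hDe
  · exact fun t => sub_nonneg.1 (hD0 t)
  · have h := hM.integrableOn_payment hκ (hXc.add hDc) huω t
    refine Integrable.sub ?_ (hM.integrableOn_payment hκ hXc huω t)
    simp only [hXc.leftLim_add hDc] at h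
    exact h
  · have h := hM.abs_payment_sub_le (Function.leftLim (fun s => X s ω) z.1
      + Function.leftLim (fun s => X' s ω - X s ω) z.1) (Function.leftLim (fun s => X s ω) z.1)
      (min z.2 (u z.1 ω))
    rw [add_sub_cancel_left, abs_of_nonneg hz] at h
    exact (le_abs_self _).trans h

theorem isClaimPath_zero : IsClaimPath 0 :=
  ⟨fun t => by simp, fun A _ => ⟨0, by simp⟩, fun t => by simp, by simp⟩

/-- If there is a reserve process for one initial reserve, there is one for every initial
reserve. -/
theorem Model.IsReserve.exists_of_initial [P.IsComplete] (hM : M.IsValid K₀)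
    (hN : IsPoissonRandomMeasure P M.intensity N)
    (hu : IsStronglyProgressive (naturalFiltration P N hN.measurable) u)
    (hmin : ∀ᵐ ω ∂P, ∀ t, M.uMin ≤ u t ω) {X : ℝ≥0 → Ω → ℝ}
    (hX : M.IsReserve P (naturalFiltration P N hN.measurable) N x u L X) (d : ℝ) :
    ∃ X', M.IsReserve P (naturalFiltration P N hN.measurable) N (x + d) u L X' := by
  classical
  set ℱ := naturalFiltration P N hN.measurable
  -- The paths with all required regularity. As `S` has full measure and the filtration contains the
  -- null sets, `S` is measurable at every time, so processes may be changed off `S` without losing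
  -- adaptedness.
  set S : Set Ω := {ω | IsClaimPath ((N ω).restrict (univ ×ˢ M.B)) ∧ IsCadlag (fun t => X t ω) ∧
    ∀ t, M.uMin ≤ u t ω}
  have hSae : ∀ᵐ ω ∂P, ω ∈ S := by
    filter_upwards [hM.ae_isClaimPath hN, hX.cadlag, hmin] with ω h1 h2 h3 using ⟨h1, h2, h3⟩
  have hSm : ∀ t, MeasurableSet[ℱ t] S := fun t => by
    have h : MeasurableSet[ℱ t] Sᶜ :=
      (le_sup_right : MeasurableSpace.generateFrom {s | P s = 0} ≤ ℱ t) _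
        (MeasurableSpace.measurableSet_generateFrom hSae)
    simpa using h.compl
  set κ : Ω → Measure (ℝ≥0 × ℝ) := fun ω => if ω ∈ S then (N ω).restrict (univ ×ˢ M.B) else 0
    with hκdef
  set g : ℝ≥0 → Ω → ℝ := fun s ω => if ω ∈ S then M.a * M.p (u s ω) else 0 with hgdef
  set Y : ℝ≥0 → Ω → ℝ := fun s ω => if ω ∈ S then X s ω else 0 with hYdef
  -- The additional payment caused by an additional fortune `v`; it is the jump term of the equation
  -- for `D`.
  set Ψ : Ω → ℝ≥0 × ℝ → ℝ → ℝ := fun ω z v =>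
    M.payment (Function.leftLim (fun s => Y s ω) z.1 + v) (min z.2 (u z.1 ω))
      - M.payment (Function.leftLim (fun s => Y s ω) z.1) (min z.2 (u z.1 ω)) with hΨdef
  have hup := fun ω => IsStronglyProgressive.measurable_path hu ω
  have hκ : ∀ ω, IsClaimPath (κ ω) := fun ω => by
    by_cases h : ω ∈ S
    · simpa only [hκdef, if_pos h] using h.1
    · simpa only [hκdef, if_neg h] using isClaimPath_zero
  have hYc : ∀ ω, IsCadlag fun s => Y s ω := fun ω => by
    by_cases h : ω ∈ S
    · simpa only [hYdef, if_pos h] using h.2.1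
    · simpa only [hYdef, if_neg h] using isCadlag_of_continuous continuous_const
  have hYm : ∀ t, Measurable[ℱ t] (Y t) := fun t =>
    measurable_ite_mem (hSm t) (hX.adapted t).measurable 0
  have hg : ∀ ω, Measurable fun s => g s ω := fun ω => by
    by_cases h : ω ∈ S
    · simp only [hgdef, if_pos h]
      exact (hM.monotone_p.measurable.comp (hup ω)).const_mul M.a
    · simpa only [hgdef, if_neg h] using measurable_const
  have h0 : ∀ ω s, 0 ≤ g s ω := fun ω s => by
    simp only [hgdef]
    split_ifs with h
    · exact mul_nonneg hM.a_nonneg (hM.p_nonneg (h.2.2 s))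
    · exact le_rfl
  have hC : ∀ ω s, g s ω ≤ M.rateBound := fun ω s => by
    simp only [hgdef]
    split_ifs
    · exact hM.rate_le _
    · exact hM.rateBound_nonneg
  have hgm : ∀ t, Measurable[NNReal.measurableSpace.prod (ℱ t)]
      fun p : ℝ≥0 × Ω => g (min p.1 t) p.2 := fun t => by
    let := ℱ t
    exact Measurable.ite (measurable_snd (hSm t)) ((hM.monotone_p.measurable.comp
      (IsStronglyProgressive.measurable_min hu t)).const_mul M.a) measurable_const
  have hκm : ∀ t, Measurable[ℱ t] fun ω => (κ ω).restrict (Prod.fst ⁻¹' Iic t) := fun t => by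
    have h1 : Measurable[ℱ t] fun ω => (N ω).restrict (Iic t ×ˢ univ) :=
      (comap_measurable _).mono le_sup_left le_rfl
    have h2 := (measurable_measure_restrict
      (MeasurableSet.univ.prod hM.measurableSet_B : MeasurableSet ((univ : Set ℝ≥0) ×ˢ M.B))).comp h1
    have h3 := measurable_ite_mem (hSm t) h2 0
    convert h3 using 2 with ω
    simp only [hκdef, Function.comp_apply]
    split_ifs
    · rw [Measure.restrict_restrict (measurable_fst measurableSet_Iic),
        Measure.restrict_restrict (MeasurableSet.univ.prod hM.measurableSet_B), ← prod_univ,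
        inter_comm]
    · simp
  have hΨ : ∀ ω z v, |Ψ ω z v| ≤ |v| := fun ω z v => by
    have h := hM.abs_payment_sub_le (Function.leftLim (fun s => Y s ω) z.1 + v)
      (Function.leftLim (fun s => Y s ω) z.1) (min z.2 (u z.1 ω))
    rwa [add_sub_cancel_left] at h
  have hpay := hM.continuous_payment.measurable
  have hΨp : ∀ ω, Measurable (Function.uncurry (Ψ ω)) := fun ω => by
    have hl : Measurable fun q : (ℝ≥0 × ℝ) × ℝ => Function.leftLim (fun s => Y s ω) q.1.1 :=
      (hYc ω).measurable_leftLim.comp (measurable_fst.comp measurable_fst)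
    have hr : Measurable fun q : (ℝ≥0 × ℝ) × ℝ => min q.1.2 (u q.1.1 ω) :=
      (measurable_snd.comp measurable_fst).min ((hup ω).comp (measurable_fst.comp measurable_fst))
    exact (hpay.comp ((hl.add measurable_snd).prodMk hr)).sub (hpay.comp (hl.prodMk hr))
  have hΨm : ∀ t, Measurable[(ℱ t).prod inferInstance]
      fun q : Ω × ((ℝ≥0 × ℝ) × ℝ) => Ψ q.1 (min q.2.1.1 t, q.2.1.2) q.2.2 := fun t => by
    let := ℱ t
    have hsw : Measurable fun q : Ω × ((ℝ≥0 × ℝ) × ℝ) => (q.2.1.1, q.1) :=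
      (measurable_fst.comp (measurable_fst.comp measurable_snd)).prodMk measurable_fst
    have hl : Measurable fun q : Ω × ((ℝ≥0 × ℝ) × ℝ) =>
        Function.leftLim (fun s => Y s q.1) (min q.2.1.1 t) :=
      (measurable_leftLim_comp hYc (φ := fun s => min s t) (measurable_id.min measurable_const)
        (fun s => min_le_right s t) fun r hr => (hYm r).mono (ℱ.mono hr) le_rfl).comp hsw
    have hr : Measurable fun q : Ω × ((ℝ≥0 × ℝ) × ℝ) => min q.2.1.2 (u (min q.2.1.1 t) q.1) :=
      (measurable_snd.comp (measurable_fst.comp measurable_snd)).min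
        ((IsStronglyProgressive.measurable_min hu t).comp hsw)
    exact (hpay.comp ((hl.add (measurable_snd.comp measurable_snd)).prodMk hr)).sub
      (hpay.comp (hl.prodMk hr))
  set D : ℝ≥0 → Ω → ℝ := fun t ω => solution (κ ω) (fun s => g s ω) (Ψ ω) d t with hDdef
  have hDm : ∀ t, Measurable[ℱ t] (D t) :=
    measurable_solution ℱ hκ hκm hg h0 hC hgm hΨp hΨ hΨm d
  have hDc : ∀ ω, IsCadlag fun t => D t ω := fun ω =>
    isCadlag_solution (hκ ω) (hg ω) (h0 ω) (hC ω) (hΨp ω) (hΨ ω) d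
  refine ⟨fun t ω => Y t ω + D t ω, fun t => ?_, .of_forall fun ω => (hYc ω).add (hDc ω), ?_⟩
  · exact ((hYm t).add (hDm t)).stronglyMeasurable
  · filter_upwards [hSae, hX.equation] with ω hω hXe t
    have hY : (fun s => Y s ω) = fun s => X s ω := by
      funext s; simp only [hYdef, if_pos hω]
    have hYt : ∀ s, Y s ω = X s ω := fun s => congrFun hY s
    have hDe := solution_equation (hκ ω) (hg ω) (h0 ω) (hC ω) (hΨp ω) (hΨ ω) d t
    have h := (hM.reserve_add_iff (d := d) (l := fun t => L t ω) hω.1 (hup ω) hω.2.2 hω.2.1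
      (hDc ω) (hXe t)).2 (by
        simp only [hΨdef, hY, hκdef, hgdef, if_pos hω] at hDe
        simpa only [hDdef, hΨdef, hY, hκdef, hgdef, if_pos hω] using hDe)
    simp only [hYt]
    exact h

end Reserve

end Reinsurance

end

/-! ### Transfer of admissibility and comparison of ruin times -/

theorem mainTheorem5 {Ω : Type*} [MeasurableSpace Ω] (P : Measure Ω) [IsProbabilityMeasure P]
    [P.IsComplete] (M : Reinsurance.Model) (K₀ : ℝ≥0) (hM : M.IsValid K₀)
    (N : Ω → Measure (ℝ≥0 × ℝ)) (hN : Reinsurance.IsPoissonRandomMeasure P M.intensity N)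
    (x x' : ℝ) (hx : 0 ≤ x) (hxx' : x ≤ x') (u L : ℝ≥0 → Ω → ℝ)
    (huL : M.IsAdmissible P (Reinsurance.naturalFiltration P N hN.measurable) N x u L) :
    M.IsAdmissible P (Reinsurance.naturalFiltration P N hN.measurable) N x' u L ∧
      ∀ X X' : ℝ≥0 → Ω → ℝ,
        M.IsReserve P (Reinsurance.naturalFiltration P N hN.measurable) N x u L X →
        M.IsReserve P (Reinsurance.naturalFiltration P N hN.measurable) N x' u L X' →
        ∀ᵐ ω ∂P, Reinsurance.ruinTime X ω ≤ Reinsurance.ruinTime X' ω := by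
  refine ⟨{ huL with dividend_le := ?_ }, fun X X' hX hX' => ?_⟩
  · obtain ⟨X, hX, hdiv⟩ := huL.dividend_le
    obtain ⟨X', hX'⟩ := hX.exists_of_initial hM hN huL.progressive_u huL.uMin_le (x' - x)
    rw [add_sub_cancel] at hX'
    refine ⟨X', hX', ?_⟩
    have hle : ∀ᵐ ω ∂P, ∀ t, Function.leftLim (fun s => X s ω) t
        ≤ Function.leftLim (fun s => X' s ω) t := by
      filter_upwards [hX.ae_le hM hN hxx' huL.progressive_u huL.uMin_le hX', hX.cadlag, hX'.cadlag]
        with ω h hc hc' t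
      have h1 := (hc'.sub hc).mem_leftLim (S := Ici 0) isClosed_Ici (t := t)
        (sub_nonneg.2 (h 0)) fun s _ => sub_nonneg.2 (h s)
      rw [hc'.leftLim_sub hc] at h1
      exact sub_nonneg.1 h1
    -- A `P`-null set of `ω` remains null for `P ⊗ dt`, as required by the dividend constraint.
    have hle' : ∀ᵐ q : Ω × ℝ≥0 ∂(P.prod Reinsurance.timeMeasure), ∀ t,
        Function.leftLim (fun s => X s q.1) t ≤ Function.leftLim (fun s => X' s q.1) t :=
      Measure.quasiMeasurePreserving_fst.ae hle
    filter_upwards [hdiv, hle'] with q h1 h2 using h1.trans (h2 q.2)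
  · filter_upwards [hX.ae_le hM hN hxx' huL.progressive_u huL.uMin_le hX'] with ω h
    -- Every time with `X' ≤ 0` also has `X ≤ 0`, so the infimum for `X` runs over a larger set.
    exact le_iInf₂ fun t ht => iInf₂_le t ((h t).trans ht)
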